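/- **Definitions.** All graphs are finite, simple and undirected. A *two-rooted graph* is a triple $(H,s,t)$ where $H$ is a graph and $s,t$ are (not necessarily distinct) vertices of $H$. A *copy* of $(\hat H,\hat s,\hat t)$ in a graph $G$ is a triple $(H,s,t)$ such that $H$ is an induced subgraph of $G$ and there is an isomorphism $\hat H\to H$ mapping $\hat s$ to $s$ and $\hat t$ to $t$. An *extension* of the copy in $G$ is given by two distinct non-adjacent vertices $s',t'\in V(G)\setminus V(H)$ such that $s$ is the only neighbor of $s'$ in $V(H)$ and $t$ is the only neighbor of $t'$ in $V(H)$. The extension is *closable* if there is an induced $s',t'$-path in $G$ having no vertex in common with the closed neighborhood $N_G[V(H)]$ except $s'$ and $t'$. The copy is *avoidable* if all its extensions in $G$ are closable. The two-rooted graph $(\hat H,\hat s,\hat t)$ is *inherent* if every graph that contains an induced copy of $\hat H$ contains an avoidable copy of $(\hat H,\hat s,\hat t)$, and *non-inherent* otherwise. Two-rooted graphs $(H,s_1,t_1)$ and $(H,s_2,t_2)$ are *equivalent* if some automorphism of $H$ maps $s_1$ to $s_2$ and some (possibly different) automorphism of $H$ maps $t_1$ to $t_2$. For $p,q,r\ge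 0$ with $p+q+r>0$, the comb $F(p,q,r)$ consists of a path $(a_1,\dots,a_{p+q+r})$ together with a pendant edge $a_ib_i$ for each $i\in\{p+1,\dots,p+q\}$. Let - $T_1(p,q,r)=(F(p,q,r),a_1,a_p)$ for $p\ge 1$ (*two-rooted combs of type I*); - $T_2(p,q)=(F(p,q,p),a_1,a_{p+q+1})$ for $p,q\ge 1$ (*two-rooted combs of type II*); - $T_4(q)$, for $q\ge 2$, be obtained from $T_2(2,q)$ by subdividing once every edge $a_ib_i$, $3\le i\le q+2$; a *two-rooted rake* is any two-rooted graph equivalent to some $T_4(q)$; - $T_5(q)$, for $q\ge 3$, be obtained from $T_4(q)$ by attaching a pendant edge to the vertex subdividing $a_ib_i$ for every $4\le i\le q+1$; a *two-rooted split rake* is any two-rooted graph equivalent to some $T_5(q)$. For $d\ge 2$, the *full depth-$d$ tree* is the tree in which every vertex has degree $1$ or $3$ and which has a vertex $c$ such that the leaves are exactly the vertices at distance $d$ from $c$. A *two-rooted leaf-extended full tree* is obtained from it, for some $d\ge2$, by attaching a pendant edge to every leaf and choosing as $s$ and $t$ arbitrary vertices of degree one and two, respectively, of the resulting tree. **Theorem.**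 The following two-rooted graphs are non-inherent. 1. Two-rooted combs of type II, that is, $T_2(p,q)$ for all $p,q\ge 1$. 2. Two-rooted rakes and two-rooted split rakes, with non-adjacent roots (in particular $T_4(q)$ for all $q\ge 2$ and $T_5(q)$ for all $q\ge 3$). 3. Two-rooted leaf-extended full trees with non-adjacent roots. 4. The two-rooted paths $(P,s,t)$ where $P=(v_0,\dots,v_\ell)$ is a path of length $\ell$, $s=v_0$, and either $t=v_0$ and $\ell\ge 1$ (these are the graphs $T_1(1,0,\ell)$), or $t=v_{\ell-1}$ and $\ell\ge 3$ (these are the graphs $T_1(\ell,0,1)$). 5. The two-rooted combs of type I $T_1(1,0,2)$, $T_1(1,0,3)$, $T_1(1,1,1)$, $T_1(1,1,2)$, $T_1(1,2,1)$, $T_1(1,3,1)$, $T_1(1,4,1)$, $T_1(2,0,2)$, $T_1(2,0,3)$, $T_1(2,1,1)$, $T_1(2,1,2)$, $T_1(2,2,1)$, $T_1(2,3,1)$, $T_1(2,4,1)$ and $T_1(3,0,3)$. -/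

import Mathlib

/-- A two-rooted graph `(H, s, t)` on the vertex type `V`; the roots may coincide. -/
structure TwoRooted (V : Type*) where
  graph : SimpleGraph V
  s : V
  t : V

namespace TwoRooted

/-- `(G[S], s, t)` is a copy of the two-rooted graph `R` in `G`: the set `S` induces a subgraph of
`G` that is the image of an isomorphism from `R.graph` sending the roots of `R` to `s` and `t`. -/
def IsCopy {V W : Type*} (R : TwoRooted V) (G : SimpleGraph W) (S : Set W) (s t : W) : Prop :=
  ∃ f : R.graph ↪g G, Set.range f = S ∧ f R.s = s ∧ f R.t = t

end TwoRooted

/-- The closed neighborhood `N_G[S]`. -/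
def closedNbhd {W : Type*} (G : SimpleGraph W) (S : Set W) : Set W :=
  S ∪ {v | ∃ u ∈ S, G.Adj u v}

/-- `(G[S ∪ {s', t'}], s', t')` is an extension of `(G[S], s, t)`: it arises from `G[S]` by adding
two distinct new vertices `s'`, `t'` whose only neighbors in it are `s` and `t` respectively. -/
def IsExtension {W : Type*} (G : SimpleGraph W) (S : Set W) (s t s' t' : W) : Prop :=
  s' ∉ S ∧ t' ∉ S ∧ s' ≠ t' ∧ ¬ G.Adj s' t' ∧
    (∀ v ∈ S, G.Adj s' v ↔ v = s) ∧ (∀ v ∈ S, G.Adj t' v ↔ v = t)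

/-- There is an induced path of `G` from `s'` to `t'` having no vertex in common with `N_G[S]`
except `s'` and `t'`. -/
def IsClosable {W : Type*} (G : SimpleGraph W) (S : Set W) (s' t' : W) : Prop :=
  ∃ p : G.Walk s' t', p.IsPath ∧ p.IsChordless ∧
    ∀ v ∈ p.support, v ∈ closedNbhd G S → v = s' ∨ v = t'

/-- `(G[S], s, t)` is avoidable in `G`: all its extensions are closable. -/
def IsAvoidable {W : Type*} (G : SimpleGraph W) (S : Set W) (s t : W) : Prop :=
  ∀ s' t' : W, IsExtension G S s t s' t' → IsClosable G S s' t'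

namespace TwoRooted

/-- Every finite graph containing a copy of the underlying graph contains an avoidable copy of the
two-rooted graph. -/
def IsInherent {V : Type*} (R : TwoRooted V) : Prop :=
  ∀ (W : Type) [Finite W] (G : SimpleGraph W),
    Nonempty (R.graph ↪g G) → ∃ (S : Set W) (s t : W), R.IsCopy G S s t ∧ IsAvoidable G S s t

/-- The two-rooted graphs have the same underlying graph, and corresponding roots lie in the same
orbits of its automorphism group (two possibly different automorphisms are allowed). -/
def Equivalent {V : Type*} (R R' : TwoRooted V) : Prop :=
  R'.graph = R.graph ∧ (∃ φ : R.graph ≃g R.graph, φ R.s = R'.s) ∧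
    (∃ ψ : R.graph ≃g R.graph, ψ R.t = R'.t)

/-- A path with `ℓ` edges, on the vertices `v_0, …, v_ℓ`, rooted at `s = v_0` and `t = v_i`. -/
def path (ℓ : ℕ) (i : Fin (ℓ + 1)) : TwoRooted (Fin (ℓ + 1)) where
  graph := SimpleGraph.pathGraph (ℓ + 1)
  s := 0
  t := i

end TwoRooted

/-- Vertices of the comb `F(p,q,r)`: `a i` is `a_{i+1}` and `b j` is `b_{p+j+1}`. -/
inductive CombVertex (p q r : ℕ) : Type
  | a (i : Fin (p + q + r))
  | b (j : Fin q)

/-- The comb `F(p,q,r)`: a path `a_1, …, a_{p+q+r}` with a pendant edge `a_k b_k` added at each `a_k`,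
`p + 1 ≤ k ≤ p + q`. -/
def comb (p q r : ℕ) : SimpleGraph (CombVertex p q r) :=
  SimpleGraph.fromRel fun x y =>
    match x, y with
    | .a i, .a k => i.val + 1 = k.val
    | .a i, .b j => i.val = p + j.val
    | _, _ => False

/-- The two-rooted comb of type I, `T_1(p,q,r) = (F(p,q,r), a_1, a_p)`. -/
def T₁ (p q r : ℕ) (hp : 1 ≤ p) : TwoRooted (CombVertex p q r) where
  graph := comb p q r
  s := .a ⟨0, by omega⟩
  t := .a ⟨p - 1, by omega⟩

/-- The two-rooted comb of type II, `T_2(p,q) = (F(p,q,p), a_1, a_{p+q+1})`. -/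
def T₂ (p q : ℕ) (hp : 1 ≤ p) : TwoRooted (CombVertex p q p) where
  graph := comb p q p
  s := .a ⟨0, by omega⟩
  t := .a ⟨p + q, by omega⟩

/-- Vertices of `T_4(q)`: those of `F(2,q,2)` (`a i` is `a_{i+1}`, `b j` is `b_{j+3}`), and the
vertex `c j` subdividing the edge between `a_{j+3}` and `b_{j+3}`. -/
inductive RakeVertex (q : ℕ) : Type
  | a (i : Fin (2 + q + 2))
  | b (j : Fin q)
  | c (j : Fin q)

/-- The comb `F(2,q,2)` with every edge `a_k b_k` subdivided once. -/
def rake (q : ℕ) : SimpleGraph (RakeVertex q) :=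
  SimpleGraph.fromRel fun x y =>
    match x, y with
    | .a i, .a k => i.val + 1 = k.val
    | .a i, .c j => i.val = 2 + j.val
    | .c j, .b k => j = k
    | _, _ => False

/-- The two-rooted graph `T_4(q)`, with the roots `a_1` and `a_{q+3}` of `T_2(2,q)`. -/
def T₄ (q : ℕ) : TwoRooted (RakeVertex q) where
  graph := rake q
  s := .a ⟨0, by omega⟩
  t := .a ⟨q + 2, by omega⟩

/-- Vertices of `T_5(q)`: those of `T_4(q)`, and for each subdividing vertex `c j` other than the
first and the last one a new vertex `d j`. -/
inductive SplitRakeVertex (q : ℕ) : Type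
  | a (i : Fin (2 + q + 2))
  | b (j : Fin q)
  | c (j : Fin q)
  | d (j : {j : Fin q // j.val ≠ 0 ∧ j.val + 1 ≠ q})

/-- The graph `rake q` with a pendant edge `c_j d_j` added at every subdividing vertex other than the
first and the last one. -/
def splitRake (q : ℕ) : SimpleGraph (SplitRakeVertex q) :=
  SimpleGraph.fromRel fun x y =>
    match x, y with
    | .a i, .a k => i.val + 1 = k.val
    | .a i, .c j => i.val = 2 + j.val
    | .c j, .b k => j = k
    | .c j, .d k => j = k.val
    | _, _ => False

/-- The two-rooted graph `T_5(q)`, with the roots `a_1` and `a_{q+3}` of `T_2(2,q)`. -/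
def T₅ (q : ℕ) : TwoRooted (SplitRakeVertex q) where
  graph := splitRake q
  s := .a ⟨0, by omega⟩
  t := .a ⟨q + 2, by omega⟩

/-- `F` is a full depth-`d` tree: a tree in which every vertex has degree `1` or `3`, with a central
vertex such that the vertices of degree `1` are exactly those at distance `d` from it. -/
def IsFullTree {U : Type*} (F : SimpleGraph U) (d : ℕ) : Prop :=
  F.IsTree ∧ (∀ v, (F.neighborSet v).ncard = 1 ∨ (F.neighborSet v).ncard = 3) ∧
    ∃ c, ∀ v, (F.neighborSet v).ncard = 1 ↔ F.dist c v = d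

/-- The graph obtained from `F` by attaching a new pendant vertex to every vertex of degree `1`. -/
def leafExtend {U : Type*} (F : SimpleGraph U) :
    SimpleGraph (U ⊕ {v : U // (F.neighborSet v).ncard = 1}) :=
  SimpleGraph.fromRel fun x y =>
    match x, y with
    | .inl u, .inl v => F.Adj u v
    | .inl u, .inr v => u = v.val
    | _, _ => False

/-! To refute inherence it suffices to exhibit a finite host graph that contains the underlying
graph and in which every copy has a non-closable extension (`not_isInherent_of_confining`).
Non-closability always comes from confinement: `s'` lies in a set that can only be left through
vertices of `N[S]` other than `t'`. In the simplest case all neighbours of `s'` are already in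
`N[S]` (`not_isClosable_of_nbrs`). Three kinds of hosts are used.

Combs of type II, rakes, split rakes and leaf-extended full trees share the shape recorded by
`LegDecomposition`: a core of vertices of degree three with legs of `p` vertices, rooted at the end
of one leg and at the start of another. The host closes each leg to a cycle of length `p + 2` by two
new vertices. Counting degrees, every embedding maps the core onto the core and each leg around one
of the cycles, in either direction, so that two consecutive vertices of that cycle are omitted
(`exists_turn_notMem`). The omitted vertex next to the end of one leg serves as `s'`, and the
omitted vertex next to the start of the other leg as `t'`. The delicate point is that the start of a
leg also has degree three in the host. A core vertex can be mapped there only if it carries two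
pendant leaves (`isCherry_of_leg`); this happens only in split rakes, where `GoodCherries` excludes
it.

Paths of length `ℓ` are treated in the cycle of length `ℓ + 3` with all vertices replaced by twins:
for `ℓ ≠ 2` an induced path cannot turn back, and the two unused positions and the twins provide the
extension.

The remaining small combs of type I are settled in the Petersen, Heawood, Pappus and Tutte-Coxeter
graphs by an exhaustive search over all copies up to rotation, run in the kernel on bit masks;
`not_isInherent_T₁` is the soundness of that search. -/

/-! ### Obstructions to closability -/

/-- If a set `R` contains `u` but not `v`, and can only be left through vertices of `N[S]` other
than `v`, then no path from `u` to `v` avoids `N[S]`. -/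
theorem not_isClosable_of_separated {W : Type*} {G : SimpleGraph W} {S R : Set W} {u v : W}
    (hu : u ∈ R) (hv : v ∉ R)
    (hR : ∀ w ∈ R, ∀ z, G.Adj w z → z ∈ R ∨ (z ∈ closedNbhd G S ∧ z ≠ v)) :
    ¬ IsClosable G S u v := by
  rintro ⟨p, -, -, hp⟩
  have key : ∀ {a b : W} (p : G.Walk a b), a ∈ R → b ∉ R → b = v →
      (∀ x ∈ p.support, x ∈ closedNbhd G S → x = u ∨ x = v) → False := by
    intro a b p
    induction p with
    | nil => intro h1 h2; exact absurd h1 h2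
    | @cons a z b hadj p ih =>
      intro ha hb hbv h
      -- A step out of `R` would enter `N[S]` at a vertex other than `v`. The only such vertex
      -- allowed on the path is `u`, which is in `R`.
      have hz : z ∈ R := by
        rcases hR a ha z hadj with h1 | ⟨h1, h2⟩
        · exact h1
        · rcases h z (by simp) h1 with rfl | h3
          · exact hu
          · exact absurd h3 h2
      exact ih hz hb hbv fun x hx => h x (by simp [hx])
  exact key p hu hv rfl hp

/-- If every neighbour of `u` lies in `N[S]`, then `u` cannot be joined to a non-adjacent `v`. -/
theorem not_isClosable_of_nbrs {W : Type*} {G : SimpleGraph W} {S : Set W} {u v : W}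
    (huv : u ≠ v) (hadj : ¬ G.Adj u v) (h : ∀ z, G.Adj u z → z ∈ closedNbhd G S) :
    ¬ IsClosable G S u v := by
  refine not_isClosable_of_separated (R := {u}) rfl (fun h => huv h.symm) ?_
  rintro w rfl z hz
  exact Or.inr ⟨h z hz, by rintro rfl; exact hadj hz⟩

namespace TwoRooted

/-- It suffices to find a finite graph in which every copy has a non-closable extension. -/
theorem not_isInherent_of_confining {V : Type*} {R : TwoRooted V} {W : Type} [Finite W]
    (G : SimpleGraph W) (hne : Nonempty (R.graph ↪g G))
    (h : ∀ f : R.graph ↪g G, ∃ s' t', IsExtension G (Set.range f) (f R.s) (f R.t) s' t' ∧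
      ¬ IsClosable G (Set.range f) s' t') : ¬ R.IsInherent := by
  intro hR
  obtain ⟨S, s, t, ⟨f, rfl, rfl, rfl⟩, hav⟩ := hR W G hne
  obtain ⟨s', t', hext, hcl⟩ := h f
  exact hcl (hav s' t' hext)

end TwoRooted

/-! ### Checking small graphs -/

namespace BitGraph

/-- Row `x` of the adjacency matrix of order `n` encoded in the binary digits of `M`. -/
def row (n M x : ℕ) : ℕ := (M >>> (x * n)) % 2 ^ n

/-- The vertices `v < n` that can be the image of the vertex of index `i`, when `xs` lists the
images of the vertices of smaller indices in decreasing order. -/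
def candidates (n M : ℕ) (h : ℕ → ℕ → Bool) (i : ℕ) : List ℕ → ℕ
  | [] => 2 ^ n - 1
  | x :: xs =>
    bif h i xs.length then candidates n M h i xs &&& row n M x
    else candidates n M h i xs ^^^ (candidates n M h i xs &&& (row n M x ||| 2 ^ x))

/-- Whether all elements of the set with bit mask `m` and at most `k` elements satisfy `P`. -/
def allBits (P : ℕ → Bool) : ℕ → ℕ → Bool
  | _, 0 => true
  | 0, _ + 1 => false
  | k + 1, m + 1 => P (m + 1).log2 && allBits P k ((m + 1) ^^^ 2 ^ (m + 1).log2)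

/-- Whether one of the `k` largest elements of the set with bit mask `m` satisfies `P`. -/
def anyBits (P : ℕ → Bool) : ℕ → ℕ → Bool
  | _, 0 => false
  | 0, _ + 1 => false
  | k + 1, m + 1 => P (m + 1).log2 || anyBits P k ((m + 1) ^^^ 2 ^ (m + 1).log2)

/-- The neighbourhood of the `k` largest elements of the set with bit mask `m`. -/
def nbrs (n M : ℕ) : ℕ → ℕ → ℕ
  | _, 0 => 0
  | 0, _ + 1 => 0
  | k + 1, m + 1 => row n M (m + 1).log2 ||| nbrs n M k ((m + 1) ^^^ 2 ^ (m + 1).log2)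

/-- Whether `leaf` holds for all extensions of `xs` by `k` further vertices to the list of images
of an induced copy of the graph with adjacency `h`. -/
def search (n M : ℕ) (h : ℕ → ℕ → Bool) (leaf : List ℕ → Bool) : ℕ → List ℕ → Bool
  | 0, xs => leaf xs
  | k + 1, xs => allBits (fun v => search n M h leaf k (v :: xs)) n (candidates n M h xs.length xs)

/-- The set of entries of a list, as a bit mask. -/
def mask : List ℕ → ℕ
  | [] => 0
  | x :: xs => mask xs ||| 2 ^ x

/-- The closed neighbourhood of the set of entries of a list, as a bit mask. -/
def nbhdMask (n M : ℕ) : List ℕ → ℕ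
  | [] => 0
  | x :: xs => nbhdMask n M xs ||| (row n M x ||| 2 ^ x)

/-- Whether `v` is not in `R` and `R` can only be left through vertices of `B` other than `v`. -/
def separates (n M B R v : ℕ) : Bool :=
  !R.testBit v && allBits (fun w => !(row n M w).testBit v && (row n M w &&& (R ||| B)) == row n M w) n R

/-- Vertices reachable outside of `B` from `R`. -/
def reach (n M B : ℕ) : ℕ → ℕ → ℕ
  | 0, R => R
  | k + 1, R => reach n M B k (R ||| (nbrs n M n R ^^^ (nbrs n M n R &&& B)))

/-- Whether the copy with the set of vertices `S`, its closed neighbourhood `B` and the roots `s`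
and `t` has a non-closable extension. -/
def hasBadExtension (n M S B s t : ℕ) : Bool :=
  anyBits (fun u => !S.testBit u && ((row n M u &&& S) == 2 ^ s) &&
    anyBits (fun v => !S.testBit v && ((row n M v &&& S) == 2 ^ t) && u != v &&
      separates n M B (reach n M B 3 (2 ^ u)) v) n (row n M t)) n (row n M s)

/-- Whether the copy on the vertices `xs` with the roots of indices `i` and `j` has a non-closable
extension. -/
def leafTest (n M i j : ℕ) (xs : List ℕ) : Bool :=
  hasBadExtension n M (mask xs) (nbhdMask n M xs) (xs.getD (xs.length - 1 - i) 0)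
    (xs.getD (xs.length - 1 - j) 0)

end BitGraph

/-! ### Invariance under automorphisms -/

theorem IsExtension.of_iso {W : Type*} {G : SimpleGraph W} (σ : G ≃g G) {S : Set W}
    {s t s' t' : W} (h : IsExtension G (σ '' S) (σ s) (σ t) (σ s') (σ t')) :
    IsExtension G S s t s' t' := by
  obtain ⟨h1, h2, h3, h4, h5, h6⟩ := h
  refine ⟨fun h => h1 ⟨_, h, rfl⟩, fun h => h2 ⟨_, h, rfl⟩, fun h => h3 (by rw [h]),
    fun h => h4 (σ.map_adj_iff.2 h), fun v hv => ?_, fun v hv => ?_⟩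
  · rw [← σ.map_adj_iff, h5 _ ⟨v, hv, rfl⟩, σ.injective.eq_iff]
  · rw [← σ.map_adj_iff, h6 _ ⟨v, hv, rfl⟩, σ.injective.eq_iff]

theorem mem_closedNbhd_image_iff {W : Type*} {G : SimpleGraph W} (σ : G ≃g G) {S : Set W} {v : W} :
    σ v ∈ closedNbhd G (σ '' S) ↔ v ∈ closedNbhd G S := by
  simp [closedNbhd, σ.map_adj_iff]

theorem IsClosable.map_iso {W : Type*} {G : SimpleGraph W} (σ : G ≃g G) {S : Set W} {u v : W}
    (h : IsClosable G S u v) : IsClosable G (σ '' S) (σ u) (σ v) := by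
  obtain ⟨p, hp, hc, h⟩ := h
  refine ⟨p.map σ.toHom, hp.map σ.injective, ?_, ?_⟩
  · rw [SimpleGraph.Walk.isChordless_iff_forall_mem_edges] at hc ⊢
    intro a b ha hb hab
    rw [SimpleGraph.Walk.support_map, List.mem_map] at ha hb
    obtain ⟨x, hx, rfl⟩ := ha
    obtain ⟨y, hy, rfl⟩ := hb
    rw [SimpleGraph.Walk.edges_map, List.mem_map]
    exact ⟨s(x, y), hc hx hy (σ.map_adj_iff.1 hab), rfl⟩
  · intro x hx hxS
    rw [SimpleGraph.Walk.support_map, List.mem_map] at hx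
    obtain ⟨y, hy, rfl⟩ := hx
    have := h y hy ((mem_closedNbhd_image_iff σ).1 hxS)
    rcases this with rfl | rfl <;> simp

/-! ### Soundness of the tests on bit masks -/

namespace BitGraph

theorem row_lt (n M x : ℕ) : row n M x < 2 ^ n := Nat.mod_lt _ (by positivity)

theorem lt_of_testBit_row {n M x y : ℕ} (h : (row n M x).testBit y = true) : y < n := by
  by_contra hy
  rw [Nat.testBit_lt_two_pow ((row_lt n M x).trans_le (Nat.pow_le_pow_right (by norm_num)
    (not_lt.1 hy)))] at h
  exact absurd h (by simp)

/-- Exhausted fuel with bits left over yields `false`, so a positive answer has examined every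
element, whatever the fuel was. -/
theorem of_allBits {P : ℕ → Bool} {k m v : ℕ} (h : allBits P k m = true)
    (hv : m.testBit v = true) : P v = true := by
  induction k generalizing m with
  | zero => cases m with
    | zero => simp at hv
    | succ m => simp [allBits] at h
  | succ k ih => cases m with
    | zero => simp at hv
    | succ m =>
      simp only [allBits, Bool.and_eq_true] at h
      by_cases hl : v = (m + 1).log2
      · exact hl ▸ h.1
      · refine ih h.2 ?_
        rw [Nat.testBit_xor, hv, Nat.testBit_two_pow_of_ne (Ne.symm hl)]
        rfl

theorem exists_of_anyBits {P : ℕ → Bool} {k m : ℕ} (h : anyBits P k m = true) :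
    ∃ v, m.testBit v = true ∧ P v = true := by
  induction k generalizing m with
  | zero => cases m <;> simp [anyBits] at h
  | succ k ih => cases m with
    | zero => simp [anyBits] at h
    | succ m =>
      simp only [anyBits, Bool.or_eq_true] at h
      have hlog : (m + 1).testBit (m + 1).log2 = true := Nat.testBit_log2 (by simp)
      rcases h with h | h
      · exact ⟨_, hlog, h⟩
      · obtain ⟨v, hv, hP⟩ := ih h
        refine ⟨v, ?_, hP⟩
        by_cases hl : v = (m + 1).log2
        · exact hl ▸ hlog
        · rwa [Nat.testBit_xor, Nat.testBit_two_pow_of_ne (Ne.symm hl), Bool.xor_false] at hv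

theorem testBit_mask {xs : List ℕ} {v : ℕ} : (mask xs).testBit v = true ↔ v ∈ xs := by
  induction xs with
  | nil => simp [mask]
  | cons x xs ih => 
    simp only [mask, Nat.testBit_or, Bool.or_eq_true, ih, Nat.testBit_two_pow, decide_eq_true_eq,
      List.mem_cons, eq_comm (a := v), or_comm]

theorem of_testBit_nbhdMask {n M : ℕ} {xs : List ℕ} {v : ℕ}
    (h : (nbhdMask n M xs).testBit v = true) :
    ∃ x ∈ xs, v = x ∨ (row n M x).testBit v = true := by
  induction xs with
  | nil => simp [nbhdMask] at h
  | cons x xs ih =>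
    simp only [nbhdMask, Nat.testBit_or, Bool.or_eq_true, Nat.testBit_two_pow,
      decide_eq_true_eq] at h
    rcases h with h | h | h
    · obtain ⟨y, hy, h⟩ := ih h
      exact ⟨y, by simp [hy], h⟩
    · exact ⟨x, by simp, Or.inr h⟩
    · exact ⟨x, by simp, Or.inl h.symm⟩

theorem testBit_reach {n M B k R v : ℕ} (h : R.testBit v = true) :
    (reach n M B k R).testBit v = true := by
  induction k generalizing R with
  | zero => exact h
  | succ k ih => exact ih (by simp [Nat.testBit_or, h])

/-- The images of the first `i` vertices, in decreasing order of their indices. -/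
def images (F : ℕ → ℕ) : ℕ → List ℕ
  | 0 => []
  | i + 1 => F i :: images F i

@[simp] theorem length_images (F : ℕ → ℕ) (i : ℕ) : (images F i).length = i := by
  induction i with
  | zero => rfl
  | succ i ih => simp [images, ih]

theorem mem_images {F : ℕ → ℕ} {i v : ℕ} : v ∈ images F i ↔ ∃ j < i, F j = v := by
  induction i with
  | zero => simp [images]
  | succ i ih =>
    simp only [images, List.mem_cons, ih, Nat.lt_succ_iff_lt_or_eq]
    constructor
    · rintro (rfl | ⟨j, hj, rfl⟩)
      exacts [⟨i, by simp, rfl⟩, ⟨j, by simp [hj], rfl⟩]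
    · rintro ⟨j, hj | rfl, rfl⟩
      exacts [Or.inr ⟨j, hj, rfl⟩, Or.inl rfl]

theorem getD_images {F : ℕ → ℕ} {m j : ℕ} (hj : j < m) :
    (images F m).getD (m - 1 - j) 0 = F j := by
  induction m with
  | zero => omega
  | succ m ih =>
    rcases Nat.lt_succ_iff_lt_or_eq.1 hj with h | rfl
    · have : m + 1 - 1 - j = (m - 1 - j) + 1 := by omega
      rw [this, images, List.getD_cons_succ, ih h]
    · simp [images]

/-- Only this inclusion is needed: a candidate set that is too large merely makes the search check
more than necessary. -/
theorem testBit_candidates {n M : ℕ} {h : ℕ → ℕ → Bool} {F : ℕ → ℕ} {i k : ℕ} (hn : F i < n)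
    (hF : ∀ j < k, F i ≠ F j ∧ (row n M (F j)).testBit (F i) = h i j) :
    (candidates n M h i (images F k)).testBit (F i) = true := by
  induction k with
  | zero => simp [images, candidates, hn]
  | succ k ih =>
    specialize ih fun j hj => hF j (by omega)
    obtain ⟨h1, h2⟩ := hF k (by omega)
    simp only [images, candidates, length_images]
    cases hik : h i k
    · simp [ih, h2, hik, Nat.testBit_two_pow_of_ne (Ne.symm h1), Nat.testBit_xor, Nat.testBit_and,
        Nat.testBit_or]
    · simp [ih, h2, hik]

/-- The successive images under an embedding form one branch of the search, because each image is a
candidate at its level; the leaf at the end of that branch has therefore been tested. -/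
theorem of_search {n M : ℕ} {h : ℕ → ℕ → Bool} {leaf : List ℕ → Bool} {F : ℕ → ℕ} {i k m : ℕ}
    (hik : i + k = m) (hn : ∀ i < m, F i < n)
    (hF : ∀ i < m, ∀ j < i, F i ≠ F j ∧ (row n M (F j)).testBit (F i) = h i j)
    (hs : search n M h leaf k (images F i) = true) : leaf (images F m) = true := by
  induction k generalizing i with
  | zero => obtain rfl : i = m := hik; exact hs
  | succ k ih =>
    refine ih (i := i + 1) (by omega) ?_
    rw [search, length_images] at hs
    exact of_allBits hs (testBit_candidates (hn i (by omega)) (hF i (by omega)))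

/-- The graph on `n` vertices with the given adjacency matrix. -/
def graph (n M : ℕ) (hsymm : ∀ i < n, ∀ j < n, (row n M i).testBit j = (row n M j).testBit i)
    (hirr : ∀ i < n, (row n M i).testBit i = false) : SimpleGraph (Fin n) where
  Adj i j := (row n M i).testBit j = true
  symm := ⟨fun i j h => by rw [hsymm j j.2 i i.2]; exact h⟩
  loopless := ⟨fun i h => by rw [hirr i i.2] at h; exact absurd h (by simp)⟩

/-- Soundness of the leaf test: the masks found by the computation are read back as an extension and
as a separating set for `not_isClosable_of_separated`. -/
theorem exists_extension_of_leafTest {n M : ℕ} {hsymm} {hirr} {m i j : ℕ} (hi : i < m) (hj : j < m)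
    (F : ℕ → Fin n) {S : Set (Fin n)} (hS : ∀ x, x ∈ S ↔ ∃ k < m, F k = x)
    (h : leafTest n M i j (images (fun k => F k) m) = true) :
    ∃ u v, IsExtension (graph n M hsymm hirr) S (F i) (F j) u v ∧
      ¬ IsClosable (graph n M hsymm hirr) S u v := by
  have hmem : ∀ x : Fin n, (mask (images (fun k => F k) m)).testBit x = true ↔ x ∈ S := by
    intro x
    rw [testBit_mask, mem_images, hS]
    simp only [Fin.ext_iff]
  rw [leafTest, length_images, getD_images hi, getD_images hj, hasBadExtension] at h
  obtain ⟨u, hu, h⟩ := exists_of_anyBits h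
  simp only [Bool.and_eq_true, beq_iff_eq, Bool.not_eq_true'] at h
  obtain ⟨⟨huS, hus⟩, h⟩ := h
  obtain ⟨v, hv, h⟩ := exists_of_anyBits h
  simp only [Bool.and_eq_true, beq_iff_eq, Bool.not_eq_true', bne_iff_ne, separates] at h
  obtain ⟨⟨⟨hvS, hvt⟩, huv⟩, hvR, hsep⟩ := h
  lift u to Fin n using lt_of_testBit_row hu
  lift v to Fin n using lt_of_testBit_row hv
  have hnbr : ∀ (w y x : Fin n), row n M w &&& mask (images (fun k => F k) m) = 2 ^ (y : ℕ) →
      x ∈ S → ((graph n M hsymm hirr).Adj w x ↔ x = y) := by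
    intro w y x hw hx
    have := congrArg (fun a => a.testBit x) hw
    simp only [Nat.testBit_and, (hmem x).2 hx, Bool.and_true, Nat.testBit_two_pow] at this
    change (row n M w).testBit x = true ↔ _
    rw [this, decide_eq_true_eq, Fin.ext_iff, eq_comm]
  have huR := testBit_reach (n := n) (M := M) (B := nbhdMask n M (images (fun k => F k) m))
    (k := 3) (Nat.testBit_two_pow_self (n := u))
  -- All that matters about the reachable set is that it contains `u`, since `separates` tests the
  -- separation itself. Hence the three rounds in `hasBadExtension` need no justification.
  generalize reach n M (nbhdMask n M (images (fun k => F k) m)) 3 (2 ^ (u : ℕ)) = R at *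
  have hR := fun w hw => of_allBits hsep (v := w) hw
  simp only [Bool.and_eq_true, beq_iff_eq, Bool.not_eq_true'] at hR
  refine ⟨u, v, ⟨?_, ?_, fun h => huv (by rw [h]), fun h => ?_, fun x hx => hnbr _ _ _ hus hx,
    fun x hx => hnbr _ _ _ hvt hx⟩,
    not_isClosable_of_separated (R := {x : Fin n | R.testBit x = true}) huR ?_ ?_⟩
  · rw [← hmem, huS]; simp
  · rw [← hmem, hvS]; simp
  · change (row n M u).testBit v = true at h
    simp [(hR u huR).1] at h
  · simp [hvR]
  · intro w hw z hz
    change (row n M w).testBit z = true at hz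
    obtain ⟨h1, h2⟩ := hR w hw
    have h3 := congrArg (fun a => a.testBit z) h2
    simp only [Nat.testBit_and, hz, Nat.testBit_or, Bool.true_and, Bool.or_eq_true] at h3
    refine h3.imp id fun h3 => ⟨?_, ?_⟩
    · obtain ⟨x, hx, h⟩ := of_testBit_nbhdMask h3
      obtain ⟨k, hk, rfl⟩ := mem_images.1 hx
      have hFk : F k ∈ S := (hS _).2 ⟨k, hk, rfl⟩
      rcases h with h | h
      · exact Or.inl (by rwa [Fin.ext h])
      · exact Or.inr ⟨_, hFk, h⟩
    · rintro rfl
      simp [hz] at h1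

end BitGraph

/-! ### Combs in terms of indices -/

@[simp] theorem comb_adj_a_a {p q r : ℕ} {i k : Fin (p + q + r)} :
    (comb p q r).Adj (.a i) (.a k) ↔ i.val + 1 = k.val ∨ k.val + 1 = i.val := by
  rw [comb, SimpleGraph.fromRel_adj, and_iff_right_of_imp]
  rintro h ⟨⟩
  omega

@[simp] theorem comb_adj_a_b {p q r : ℕ} {i : Fin (p + q + r)} {j : Fin q} :
    (comb p q r).Adj (.a i) (.b j) ↔ i.val = p + j.val := by
  simp [comb]

@[simp] theorem comb_adj_b_a {p q r : ℕ} {i : Fin (p + q + r)} {j : Fin q} :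
    (comb p q r).Adj (.b j) (.a i) ↔ i.val = p + j.val := by
  simp [comb]

@[simp] theorem comb_adj_b_b {p q r : ℕ} {j k : Fin q} :
    ¬ (comb p q r).Adj (.b j) (.b k) := by
  simp [comb]

namespace BitGraph

/-- The vertex of index `i` of the comb `F(p,q,r)`: the path comes first. -/
def combVertex (p q r : ℕ) (h : 0 < p + q + r) (i : ℕ) : CombVertex p q r :=
  if h1 : i < p + q + r then .a ⟨i, h1⟩
  else if h2 : i - (p + q + r) < q then .b ⟨i - (p + q + r), h2⟩ else .a ⟨0, h⟩

theorem combVertex_of_lt {p q r : ℕ} {h : 0 < p + q + r} {i : ℕ} (hi : i < p + q + r) :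
    combVertex p q r h i = .a ⟨i, hi⟩ := dif_pos hi

theorem combVertex_of_ge {p q r : ℕ} {h : 0 < p + q + r} {i : ℕ} (hi : ¬ i < p + q + r)
    (hi' : i - (p + q + r) < q) : combVertex p q r h i = .b ⟨i - (p + q + r), hi'⟩ := by
  rw [combVertex, dif_neg hi, dif_pos hi']

/-- The adjacency relation of the comb `F(p,q,r)` in terms of indices. -/
def combAdj (p q r i j : ℕ) : Bool :=
  (Nat.blt i (p + q + r) && Nat.blt j (p + q + r) && (Nat.beq (i + 1) j || Nat.beq (j + 1) i)) ||
    (Nat.blt i (p + q + r) && Nat.ble (p + q + r) j && Nat.beq (i + (p + q + r)) (p + j)) ||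
    (Nat.blt j (p + q + r) && Nat.ble (p + q + r) i && Nat.beq (j + (p + q + r)) (p + i))

theorem combAdj_eq_true {p q r i j : ℕ} : combAdj p q r i j = true ↔
    (i < p + q + r ∧ j < p + q + r ∧ (i + 1 = j ∨ j + 1 = i)) ∨
    (i < p + q + r ∧ p + q + r ≤ j ∧ i + (p + q + r) = p + j) ∨
    (j < p + q + r ∧ p + q + r ≤ i ∧ j + (p + q + r) = p + i) := by
  simp only [combAdj, Bool.or_eq_true, Bool.and_eq_true, Nat.blt_eq, Nat.beq_eq, Nat.ble_eq,
    and_assoc, or_assoc]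

theorem adj_combVertex {p q r : ℕ} {h : 0 < p + q + r} {i j : ℕ} (hi : i < p + 2 * q + r)
    (hj : j < p + 2 * q + r) :
    (comb p q r).Adj (combVertex p q r h i) (combVertex p q r h j) ↔ combAdj p q r i j = true := by
  rw [combAdj_eq_true]
  by_cases h1 : i < p + q + r <;> by_cases h2 : j < p + q + r
  · rw [combVertex_of_lt h1, combVertex_of_lt h2, comb_adj_a_a]
    simp only
    omega
  · rw [combVertex_of_lt h1, combVertex_of_ge h2 (by omega), comb_adj_a_b]
    simp only
    omega
  · rw [combVertex_of_ge h1 (by omega), combVertex_of_lt h2, comb_adj_b_a]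
    simp only
    omega
  · rw [combVertex_of_ge h1 (by omega), combVertex_of_ge h2 (by omega)]
    simp only [comb_adj_b_b, false_iff]
    omega

theorem combVertex_injOn {p q r : ℕ} {h : 0 < p + q + r} {i j : ℕ} (hi : i < p + 2 * q + r)
    (hj : j < p + 2 * q + r) (hij : combVertex p q r h i = combVertex p q r h j) : i = j := by
  unfold combVertex at hij
  split_ifs at hij <;> simp at hij <;> omega

theorem exists_combVertex {p q r : ℕ} (h : 0 < p + q + r) (x : CombVertex p q r) :
    ∃ i < p + 2 * q + r, combVertex p q r h i = x := by
  rcases x with ⟨i, hi⟩ | ⟨j, hj⟩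
  · exact ⟨i, by omega, by simp [combVertex, hi]⟩
  · exact ⟨p + q + r + j, by omega, by simp [combVertex, hj]⟩

/-! ### Exhaustive search up to rotation -/

/-- Whether `M` encodes a graph on `n` vertices invariant under the rotation by `r`. -/
def isRotationInvariant (n M r : ℕ) : Bool :=
  allBits (fun i => !(row n M i).testBit i && allBits (fun j =>
    (row n M i).testBit j == (row n M j).testBit i &&
    (row n M i).testBit j == (row n M ((i + r) % n)).testBit ((j + r) % n)) n (2 ^ n - 1))
    n (2 ^ n - 1)

/-- Rotating backwards by `r` while the position is at least `r` ends below `r`; `r` need not divide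
`n`. -/
theorem exists_iso_lt {n M r : ℕ} {hsymm} {hirr} (hr : 0 < r)
    (h : ∀ i < n, ∀ j < n,
      (row n M i).testBit j = (row n M ((i + r) % n)).testBit ((j + r) % n)) (x : Fin n) :
    ∃ σ : graph n M hsymm hirr ≃g graph n M hsymm hirr, (σ x : ℕ) < r := by
  obtain ⟨x, hx⟩ := x
  have hn : NeZero n := ⟨by omega⟩
  let ρ : graph n M hsymm hirr ≃g graph n M hsymm hirr :=
    { toEquiv := Equiv.addRight (Fin.ofNat n r)
      map_rel_iff' := by
        intro a b
        change (row n M _).testBit _ = true ↔ (row n M a).testBit b = true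
        rw [h a a.2 b b.2]
        simp [Fin.val_add] }
  induction x using Nat.strong_induction_on with
  | _ x ih =>
    by_cases hxr : x < r
    · exact ⟨RelIso.refl _, hxr⟩
    · obtain ⟨σ, hσ⟩ := ih (x - r) (by omega) (by omega)
      refine ⟨ρ.symm.trans σ, ?_⟩
      have : ρ.symm ⟨x, hx⟩ = ⟨x - r, by omega⟩ := by
        rw [RelIso.symm_apply_eq]
        ext
        simp only [ρ, RelIso.coe_fn_mk, Equiv.coe_addRight, Fin.val_add, Fin.ofNat]
        rw [Nat.add_mod_mod, Nat.sub_add_cancel (by omega), Nat.mod_eq_of_lt hx]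
      rw [RelIso.trans_apply, this]
      exact hσ

/-- The vertices of the list `ws` induce a copy of the comb. -/
def isComb (n M p q r : ℕ) (ws : List ℕ) : Bool :=
  allBits (fun i => Nat.blt (ws.getD i 0) n && allBits (fun j =>
    (row n M (ws.getD i 0)).testBit (ws.getD j 0) == combAdj p q r i j &&
    (i == j || ws.getD i 0 != ws.getD j 0)) (p + 2 * q + r) (2 ^ (p + 2 * q + r) - 1))
    (p + 2 * q + r) (2 ^ (p + 2 * q + r) - 1)

/-- The list `ws` certifies that a copy exists. Since the rotation by `ρ` is an automorphism, it is
enough to search the copies whose first root is one of the vertices below `ρ`; a bad extension of a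
rotated copy is carried back by the inverse automorphism. -/
theorem not_isInherent_T₁ {p q r : ℕ} {hp : 1 ≤ p} (n M ρ : ℕ) (ws : List ℕ) (hρ : 0 < ρ)
    (hM : isRotationInvariant n M ρ = true) (hws : isComb n M p q r ws = true)
    (hs : ∀ v < ρ, search n M (combAdj p q r) (leafTest n M 0 (p - 1)) (p + 2 * q + r - 1) [v]
      = true) : ¬ (T₁ p q r hp).IsInherent := by
  have hfull : ∀ {n i : ℕ}, i < n → (2 ^ n - 1).testBit i = true := by
    intro n i hi; simp [hi]
  have hpos : 0 < p + q + r := by omega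
  have h1 := fun i (hi : i < n) => of_allBits hM (hfull hi)
  simp only [Bool.and_eq_true, Bool.not_eq_true'] at h1
  have h2 := fun i (hi : i < n) j (hj : j < n) => of_allBits (h1 i hi).2 (hfull hj)
  simp only [Bool.and_eq_true, beq_iff_eq] at h2
  let G := graph n M (fun i hi j hj => (h2 i hi j hj).1) (fun i hi => (h1 i hi).1)
  have hidx : ∀ x : CombVertex p q r, ∃ i < p + 2 * q + r, combVertex p q r hpos i = x :=
    exists_combVertex hpos
  have h3 := fun i (hi : i < p + 2 * q + r) => of_allBits hws (hfull hi)
  simp only [Bool.and_eq_true, Nat.blt_eq] at h3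
  have h4 := fun i (hi : i < p + 2 * q + r) j (hj : j < p + 2 * q + r) =>
    of_allBits (h3 i hi).2 (hfull hj)
  simp only [Bool.and_eq_true, beq_iff_eq, Bool.or_eq_true, bne_iff_ne] at h4
  refine TwoRooted.not_isInherent_of_confining G ?_ ?_
  · choose idx hlt hidx using hidx
    refine ⟨⟨⟨fun x => ⟨ws.getD (idx x) 0, (h3 _ (hlt x)).1⟩, fun x y hxy => ?_⟩, ?_⟩⟩
    · rcases (h4 _ (hlt x) _ (hlt y)).2 with h | h
      · rw [← hidx x, ← hidx y, h]
      · exact absurd (congrArg Fin.val hxy) h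
    · intro x y
      change (row n M _).testBit _ = true ↔ (comb p q r).Adj x y
      rw [← hidx x, ← hidx y, adj_combVertex (hlt x) (hlt y), hidx x, hidx y]
      exact iff_of_eq (congrArg (· = true) (h4 _ (hlt x) _ (hlt y)).1)
  · intro f
    have main : ∀ g : (T₁ p q r hp).graph ↪g G, (g (T₁ p q r hp).s : ℕ) < ρ →
        ∃ s' t', IsExtension G (Set.range g) (g (T₁ p q r hp).s) (g (T₁ p q r hp).t) s' t' ∧
          ¬ IsClosable G (Set.range g) s' t' := by
      intro g hg
      have hs0 : (T₁ p q r hp).s = combVertex p q r hpos 0 := by simp [T₁, combVertex, hpos]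
      have ht0 : (T₁ p q r hp).t = combVertex p q r hpos (p - 1) := by
        have : p - 1 < p + q + r := by omega
        simp [T₁, combVertex, this]
      have hsr := hs _ hg
      rw [hs0] at hsr
      rw [hs0, ht0]
      refine exists_extension_of_leafTest (m := p + 2 * q + r) (by omega) (by omega)
        (fun i => g (combVertex p q r hpos i)) ?_ ?_
      · intro x
        constructor
        · rintro ⟨y, rfl⟩
          obtain ⟨i, hi, rfl⟩ := hidx y
          exact ⟨i, hi, rfl⟩
        · rintro ⟨i, -, rfl⟩
          exact ⟨_, rfl⟩
      · refine of_search (i := 1) (by omega) (fun i _ => (g _).2) (fun i hi j hj => ⟨?_, ?_⟩) hsr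
        · intro h
          exact hj.ne' (combVertex_injOn hi (hj.trans hi) (g.injective (Fin.ext h)))
        · rw [Bool.eq_iff_iff]
          have := g.map_rel_iff (a := combVertex p q r hpos i) (b := combVertex p q r hpos j)
          refine Iff.trans ?_ (this.trans (adj_combVertex hi (hj.trans hi)))
          rw [SimpleGraph.adj_comm]
          rfl
    obtain ⟨σ, hσ⟩ := exists_iso_lt (hsymm := fun i hi j hj => (h2 i hi j hj).1)
      (hirr := fun i hi => (h1 i hi).1) hρ (fun i hi j hj => (h2 i hi j hj).2)
      (f (T₁ p q r hp).s)
    obtain ⟨u, v, hext, hcl⟩ := main (f.trans σ.toRelEmbedding) hσ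
    have hrange : Set.range (f.trans σ.toRelEmbedding) = σ '' Set.range f := by
      rw [← Set.range_comp]; rfl
    rw [hrange] at hext hcl
    refine ⟨σ.symm u, σ.symm v, IsExtension.of_iso σ ?_, fun h => hcl ?_⟩
    · simpa using hext
    · simpa using h.map_iso σ

end BitGraph

/-! ### Host graphs for the small combs of type I -/

namespace BitGraph

/-- The Petersen graph. -/
def petersen : ℕ :=
  257617904308990774908043727922

/-- The Heawood graph. -/
def heawood : ℕ :=
  26687646707949578418496007226945655943241685574238173487138

/-- The Pappus graph. -/
def pappus : ℕ :=
  9078157009190347841476724983616745304928260456106773421284695237587344128309104708068253864689698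

/-- The Tutte-Coxeter graph. -/
def tutteCoxeter : ℕ :=
  2113210381874244007171659281635553199795137801983291675146387253503484449809886361323805431575212909288447151452254493738780759485919482075142767588666345654811727693902885885940387658399016105485768396026877476226788248136816147428286526149818473511288601912791399530498

theorem not_isInherent_T₁_1_0_2 {hp} : ¬ (T₁ 1 0 2 hp).IsInherent :=
  not_isInherent_T₁ 10 petersen 10 [0, 1, 2]
    (by norm_num) (by decide +kernel) (by decide +kernel) (by decide +kernel)

theorem not_isInherent_T₁_1_1_1 {hp} : ¬ (T₁ 1 1 1 hp).IsInherent :=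
  not_isInherent_T₁ 10 petersen 10 [0, 1, 2, 6]
    (by norm_num) (by decide +kernel) (by decide +kernel) (by decide +kernel)

theorem not_isInherent_T₁_2_0_2 {hp} : ¬ (T₁ 2 0 2 hp).IsInherent :=
  not_isInherent_T₁ 10 petersen 10 [0, 1, 2, 3]
    (by norm_num) (by decide +kernel) (by decide +kernel) (by decide +kernel)

theorem not_isInherent_T₁_1_1_2 {hp} : ¬ (T₁ 1 1 2 hp).IsInherent :=
  not_isInherent_T₁ 14 heawood 2 [0, 1, 2, 3, 10]
    (by norm_num) (by decide +kernel) (by decide +kernel) (by decide +kernel)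

theorem not_isInherent_T₁_1_2_1 {hp} : ¬ (T₁ 1 2 1 hp).IsInherent :=
  not_isInherent_T₁ 14 heawood 2 [0, 1, 2, 3, 10, 7]
    (by norm_num) (by decide +kernel) (by decide +kernel) (by decide +kernel)

theorem not_isInherent_T₁_2_0_3 {hp} : ¬ (T₁ 2 0 3 hp).IsInherent :=
  not_isInherent_T₁ 14 heawood 2 [0, 1, 2, 3, 4]
    (by norm_num) (by decide +kernel) (by decide +kernel) (by decide +kernel)

theorem not_isInherent_T₁_2_1_1 {hp} : ¬ (T₁ 2 1 1 hp).IsInherent :=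
  not_isInherent_T₁ 14 heawood 2 [0, 1, 2, 3, 7]
    (by norm_num) (by decide +kernel) (by decide +kernel) (by decide +kernel)

theorem not_isInherent_T₁_2_1_2 {hp} : ¬ (T₁ 2 1 2 hp).IsInherent :=
  not_isInherent_T₁ 14 heawood 2 [0, 1, 2, 3, 4, 7]
    (by norm_num) (by decide +kernel) (by decide +kernel) (by decide +kernel)

theorem not_isInherent_T₁_3_0_3 {hp} : ¬ (T₁ 3 0 3 hp).IsInherent :=
  not_isInherent_T₁ 14 heawood 2 [0, 1, 2, 3, 4, 9]
    (by norm_num) (by decide +kernel) (by decide +kernel) (by decide +kernel)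

theorem not_isInherent_T₁_2_2_1 {hp} : ¬ (T₁ 2 2 1 hp).IsInherent :=
  not_isInherent_T₁ 18 pappus 6 [0, 1, 2, 3, 4, 13, 10]
    (by norm_num) (by decide +kernel) (by decide +kernel) (by decide +kernel)

theorem not_isInherent_T₁_1_3_1 {hp} : ¬ (T₁ 1 3 1 hp).IsInherent :=
  not_isInherent_T₁ 30 tutteCoxeter 6 [0, 1, 2, 3, 4, 22, 9, 26]
    (by norm_num) (by decide +kernel) (by decide +kernel) (by decide +kernel)

theorem not_isInherent_T₁_1_4_1 {hp} : ¬ (T₁ 1 4 1 hp).IsInherent :=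
  not_isInherent_T₁ 30 tutteCoxeter 6 [0, 1, 2, 3, 4, 5, 22, 9, 26, 13]
    (by norm_num) (by decide +kernel) (by decide +kernel) (by decide +kernel)

theorem not_isInherent_T₁_2_3_1 {hp} : ¬ (T₁ 2 3 1 hp).IsInherent :=
  not_isInherent_T₁ 30 tutteCoxeter 6 [0, 1, 2, 3, 4, 5, 9, 26, 13]
    (by norm_num) (by decide +kernel) (by decide +kernel) (by decide +kernel)

theorem not_isInherent_T₁_2_4_1 {hp} : ¬ (T₁ 2 4 1 hp).IsInherent :=
  not_isInherent_T₁ 30 tutteCoxeter 6 [0, 1, 2, 3, 4, 5, 6, 9, 26, 13, 18]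
    (by norm_num) (by decide +kernel) (by decide +kernel) (by decide +kernel)

end BitGraph

/-! ### Cycles of twins, the hosts for paths -/

/-- The cycle of length `n` with every vertex replaced by two non-adjacent twins. -/
def twinCycle (n : ℕ) (hn : 1 < n) : SimpleGraph (ZMod n × Bool) where
  Adj x y := y.1 = x.1 + 1 ∨ x.1 = y.1 + 1
  symm := ⟨fun _ _ h => h.symm⟩
  loopless := ⟨fun x h => by
    have : Fact (1 < n) := ⟨hn⟩
    simp at h⟩

namespace twinCycle

section

variable {n : ℕ} {hn : 1 < n} {x₀ ε : ZMod n}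

theorem pos_inj (hε : ε * ε = 1) {k j : ℕ} (hk : k < n) (hj : j < n) :
    x₀ + k * ε = x₀ + j * ε ↔ k = j := by
  refine ⟨fun h => ?_, fun h => by rw [h]⟩
  have h1 : (k : ZMod n) = j := by
    have := congrArg (· * ε) (add_left_cancel h)
    simpa [mul_assoc, hε] using this
  rw [ZMod.natCast_eq_natCast_iff', Nat.mod_eq_of_lt hk, Nat.mod_eq_of_lt hj] at h1
  exact h1

theorem exists_pos (hε : ε * ε = 1) (z : ZMod n) [NeZero n] : ∃ k < n, x₀ + (k : ℕ) * ε = z := by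
  refine ⟨((z - x₀) * ε).val, ZMod.val_lt _, ?_⟩
  rw [ZMod.natCast_val, ZMod.cast_id', id, mul_assoc, hε]
  ring

theorem adj_pos (hε : ε = 1 ∨ ε = -1) {k j : ℕ} (hk : k < n) (hj : j < n) {a b : Bool} :
    (twinCycle n hn).Adj (x₀ + k * ε, a) (x₀ + j * ε, b) ↔
      j = k + 1 ∨ k = j + 1 ∨ (k = n - 1 ∧ j = 0) ∨ (j = n - 1 ∧ k = 0) := by
  have hε' : ε * ε = 1 := by rcases hε with rfl | rfl <;> simp
  have hadj : (twinCycle n hn).Adj (x₀ + k * ε, a) (x₀ + j * ε, b) ↔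
      x₀ + j * ε = x₀ + (k + 1 : ℕ) * ε ∨ x₀ + k * ε = x₀ + (j + 1 : ℕ) * ε := by
    change x₀ + j * ε = x₀ + k * ε + 1 ∨ x₀ + k * ε = x₀ + j * ε + 1 ↔ _
    rcases hε with rfl | rfl
    · simp [add_assoc]
    · rw [or_comm]
      refine or_congr ?_ ?_ <;> push_cast <;> constructor <;> intro h <;> linear_combination -h
  have hsucc : ∀ {k j : ℕ}, k < n → j < n →
      (x₀ + j * ε = x₀ + (k + 1 : ℕ) * ε ↔ j = k + 1 ∨ (k = n - 1 ∧ j = 0)) := by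
    intro k j hk hj
    by_cases h : k + 1 < n
    · rw [pos_inj hε' hj h]; omega
    · obtain rfl : n = k + 1 := by omega
      have := pos_inj (x₀ := x₀) hε' hj (show 0 < k + 1 by omega)
      rw [ZMod.natCast_self, zero_mul]
      rw [Nat.cast_zero, zero_mul] at this
      rw [this]; omega
  rw [hadj, hsucc hk hj, hsucc hj hk]
  omega

/-- An induced path of length at least three runs around the cycle in one direction. -/
theorem exists_pos_of_embedding {ℓ : ℕ} (hℓ : 1 ≤ ℓ) (hℓ2 : ℓ ≠ 2)
    (f : SimpleGraph.pathGraph (ℓ + 1) ↪g twinCycle n hn) :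
    ∃ ε : ZMod n, (ε = 1 ∨ ε = -1) ∧
      ∀ i : Fin (ℓ + 1), (f i).1 = (f 0).1 + (i.val : ZMod n) * ε := by
  have hadj : ∀ (i j : ℕ) (hi : i < ℓ + 1) (hj : j < ℓ + 1),
      ((f ⟨j, hj⟩).1 = (f ⟨i, hi⟩).1 + 1 ∨ (f ⟨i, hi⟩).1 = (f ⟨j, hj⟩).1 + 1) ↔
        i + 1 = j ∨ j + 1 = i := by
    intro i j hi hj
    have := f.map_rel_iff (a := ⟨i, hi⟩) (b := ⟨j, hj⟩)
    rw [SimpleGraph.pathGraph_adj] at this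
    exact this
  -- If the path turned back, its vertices `i` and `i + 2` would be twins. The path vertex `i + 3`
  -- or `i - 1` would then be adjacent to both, contrary to the path being induced. One of these
  -- exists because `ℓ ≠ 2`.
  have hne : ∀ (i : ℕ) (hi : i + 2 < ℓ + 1), (f ⟨i, by omega⟩).1 ≠ (f ⟨i + 2, hi⟩).1 := by
    intro i hi heq
    by_cases h : i + 3 < ℓ + 1
    · have h1 := (hadj (i + 2) (i + 3) hi h).2 (Or.inl rfl)
      rw [← heq, hadj] at h1
      omega
    · have h0 : 0 < i := by omega
      have h1 := (hadj i (i - 1) (by omega) (by omega)).2 (by omega)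
      rw [heq, hadj] at h1
      omega
  have h1 := (hadj 0 1 (by omega) (by omega)).2 (Or.inl rfl)
  obtain ⟨ε, hε, h1⟩ : ∃ ε : ZMod n, (ε = 1 ∨ ε = -1) ∧
      (f ⟨1, by omega⟩).1 = (f ⟨0, by omega⟩).1 + ε := by
    rcases h1 with h1 | h1
    · exact ⟨1, Or.inl rfl, h1⟩
    · exact ⟨-1, Or.inr rfl, by rw [h1]; ring⟩
  refine ⟨ε, hε, fun ⟨i, hi⟩ => ?_⟩
  induction i using Nat.strong_induction_on with
  | _ i ih =>
    rcases i with _ | _ | i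
    · simp
    · simpa using h1
    · have e1 := ih i (by omega) (by omega)
      have e2 := ih (i + 1) (by omega) (by omega)
      have e3 := hne i hi
      have e4 := (hadj (i + 1) (i + 2) (by omega) hi).2 (Or.inl rfl)
      rw [e1] at e3
      rw [e2] at e4
      push_cast at e3 e4 ⊢
      rcases hε with rfl | rfl <;> rcases e4 with e4 | e4
      · rw [e4]; ring
      · exact absurd (by linear_combination e4) e3
      · exact absurd (by linear_combination -e4) e3
      · linear_combination -e4

end

theorem nonempty_embedding {ℓ : ℕ} :
    Nonempty (SimpleGraph.pathGraph (ℓ + 1) ↪g twinCycle (ℓ + 3) (by omega)) := by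
  have hmul : (1 : ZMod (ℓ + 3)) * 1 = 1 := by simp
  refine ⟨⟨⟨fun i => (0 + (i.val : ZMod (ℓ + 3)) * 1, false), fun i j h => ?_⟩, ?_⟩⟩
  · exact Fin.ext ((pos_inj hmul (by omega) (by omega)).1 (congrArg Prod.fst h))
  · intro i j
    change (twinCycle (ℓ + 3) (by omega)).Adj (_, false) (_, false) ↔ _
    rw [adj_pos (Or.inl rfl) (by omega) (by omega), SimpleGraph.pathGraph_adj]
    omega

/-- Non-closable extensions of a path that runs around a cycle of length `ℓ + 3`. -/
theorem exists_extension {ℓ : ℕ} (hℓ : 1 ≤ ℓ) (hℓ2 : ℓ ≠ 2)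
    (f : SimpleGraph.pathGraph (ℓ + 1) ↪g twinCycle (ℓ + 3) (by omega)) (m : ℕ) (hm : m < ℓ + 1)
    (h : m = 0 ∨ m = ℓ - 1) :
    ∃ s' t', IsExtension (twinCycle (ℓ + 3) (by omega)) (Set.range f) (f 0) (f ⟨m, hm⟩) s' t' ∧
      ¬ IsClosable (twinCycle (ℓ + 3) (by omega)) (Set.range f) s' t' := by
  obtain ⟨ε, hε, hf⟩ := exists_pos_of_embedding hℓ hℓ2 f
  have hε' : ε * ε = 1 := by rcases hε with rfl | rfl <;> simp
  generalize (f 0).1 = x₀ at hf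
  have hf' : ∀ i : Fin (ℓ + 1), f i = (x₀ + (i.val : ZMod (ℓ + 3)) * ε, (f i).2) :=
    fun i => Prod.ext (hf i) rfl
  have hadj : ∀ {k j : ℕ} (hk : k < ℓ + 3) (hj : j < ℓ + 3) {a b : Bool},
      (twinCycle (ℓ + 3) (by omega)).Adj (x₀ + k * ε, a) (x₀ + j * ε, b) ↔ _ :=
    adj_pos hε
  -- The path occupies the positions `0, …, ℓ`. The neighbours of the free position `ℓ + 2` are at
  -- the positions `0`, adjacent to the path vertex `1`, and `ℓ + 1`, adjacent to the path vertex
  -- `ℓ`, so they lie in `N[S]`.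
  have hclosed : ∀ (a : Bool) (z), (twinCycle (ℓ + 3) (by omega)).Adj
      (x₀ + (ℓ + 2 : ℕ) * ε, a) z →
      z ∈ closedNbhd (twinCycle (ℓ + 3) (by omega)) (Set.range f) := by
    rintro a ⟨z, b⟩ hz
    obtain ⟨k, hk, rfl⟩ := exists_pos (x₀ := x₀) hε' z
    rw [hadj (by omega) hk] at hz
    right
    by_cases h0 : k = 0
    · refine ⟨_, ⟨⟨1, by omega⟩, rfl⟩, ?_⟩
      rw [hf', hadj (by omega) (by omega)]
      simp only
      omega
    · refine ⟨_, ⟨⟨ℓ, by omega⟩, rfl⟩, ?_⟩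
      rw [hf', hadj (by omega) (by omega)]
      simp only
      omega
  have hnot : ∀ (a : Bool), (x₀ + (ℓ + 2 : ℕ) * ε, a) ∉ Set.range f := by
    rintro a ⟨i, hi⟩
    have h1 := congrArg Prod.fst hi
    rw [hf i, pos_inj hε' (by omega) (by omega)] at h1
    omega
  have hs : ∀ (a : Bool), ∀ v ∈ Set.range f, (twinCycle (ℓ + 3) (by omega)).Adj
      (x₀ + (ℓ + 2 : ℕ) * ε, a) v ↔ v = f 0 := by
    rintro a _ ⟨i, rfl⟩
    rw [f.injective.eq_iff, hf', hadj (by omega) (by omega), Fin.ext_iff]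
    simp only [Fin.val_zero]
    omega
  by_cases hm0 : m = 0
  -- For equal roots the extension consists of the two twins at the position `ℓ + 2`.
  · subst hm0
    have hnadj : ¬ (twinCycle (ℓ + 3) (by omega)).Adj (x₀ + (ℓ + 2 : ℕ) * ε, false)
        (x₀ + (ℓ + 2 : ℕ) * ε, true) := by
      rw [hadj (by omega) (by omega)]; omega
    exact ⟨(x₀ + (ℓ + 2 : ℕ) * ε, false), (x₀ + (ℓ + 2 : ℕ) * ε, true),
      ⟨hnot _, hnot _, by simp, hnadj, hs _, hs _⟩,
      not_isClosable_of_nbrs (by simp) hnadj (hclosed _)⟩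
  · have hnadj : ∀ b, ¬ (twinCycle (ℓ + 3) (by omega)).Adj (x₀ + (ℓ + 2 : ℕ) * ε, false)
        (x₀ + (ℓ : ℕ) * ε, b) := by
      intro b
      rw [hadj (by omega) (by omega)]; omega
    have hne : ∀ b, (x₀ + (ℓ + 2 : ℕ) * ε, false) ≠ (x₀ + (ℓ : ℕ) * ε, b) := by
      intro b hb
      have h1 := congrArg Prod.fst hb
      rw [pos_inj hε' (by omega) (by omega)] at h1
      omega
    -- Here `t'` is the twin of the last path vertex, hence the negated Boolean; its only neighbour
    -- on the path is the vertex `ℓ - 1`.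
    refine ⟨(x₀ + (ℓ + 2 : ℕ) * ε, false), (x₀ + (ℓ : ℕ) * ε, !(f (Fin.last ℓ)).2),
      ⟨hnot _, ?_, hne _, hnadj _, hs _, ?_⟩, not_isClosable_of_nbrs (hne _) (hnadj _) (hclosed _)⟩
    · rintro ⟨i, hi⟩
      have h1 := congrArg Prod.fst hi
      rw [hf i, pos_inj hε' (by omega) (by omega)] at h1
      obtain rfl : i = Fin.last ℓ := Fin.ext h1
      have h2 := congrArg Prod.snd hi
      simp at h2
    · rintro _ ⟨i, rfl⟩
      rw [f.injective.eq_iff, hf' i, hadj (by omega) (by omega), Fin.ext_iff]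
      simp only
      omega

end twinCycle

theorem not_isInherent_path {ℓ : ℕ} (hℓ : 1 ≤ ℓ) (hℓ2 : ℓ ≠ 2) (m : ℕ) (hm : m < ℓ + 1)
    (h : m = 0 ∨ m = ℓ - 1) : ¬ (TwoRooted.path ℓ ⟨m, hm⟩).IsInherent :=
  TwoRooted.not_isInherent_of_confining (W := ZMod (ℓ + 3) × Bool) (twinCycle (ℓ + 3) (by omega))
    twinCycle.nonempty_embedding fun f => twinCycle.exists_extension hℓ hℓ2 f m hm h

/-! ### Leg decompositions and their closures -/

/-- A decomposition of `H` into a core of vertices of degree three, disjoint legs of `p` vertices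
attached to the core, and, if `p > 1`, leaves attached to the core. -/
structure LegDecomposition {V : Type} (H : SimpleGraph V) (D : Type) (p : ℕ) where
  core : Set V
  root : D → V
  leg : D → ℕ → V
  pos : 1 ≤ p
  ncard_core : ∀ c ∈ core, (H.neighborSet c).ncard = 3
  root_mem : ∀ d, root d ∈ core
  adj_zero : ∀ d v, H.Adj (leg d 0) v ↔ v = root d ∨ (1 < p ∧ v = leg d 1)
  adj_succ : ∀ d i, i + 1 < p → ∀ v,
    H.Adj (leg d (i + 1)) v ↔ v = leg d i ∨ (i + 2 < p ∧ v = leg d (i + 2))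
  inj : ∀ d d' i j, i < p → j < p → leg d i = leg d' j → d = d' ∧ i = j
  notMem : ∀ d i, i < p → leg d i ∉ core
  cover : ∀ v, v ∈ core ∨ (∃ d, ∃ i < p, v = leg d i) ∨
    (1 < p ∧ ∃ c ∈ core, ∀ w, H.Adj v w ↔ w = c)

namespace LegDecomposition

variable {V D : Type} {H : SimpleGraph V} {p : ℕ} (L : LegDecomposition H D p)

/-- A leaf attached to the core. -/
def IsPlain (v : V) : Prop := 1 < p ∧ ∃ c ∈ L.core, ∀ w, H.Adj v w ↔ w = c

/-- A vertex with two leaves attached to it. -/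
def IsCherry (c : V) : Prop :=
  ∃ y y', y ≠ y' ∧ L.IsPlain y ∧ L.IsPlain y' ∧ H.Adj c y ∧ H.Adj c y'

/-- Every leg is closed to a cycle of length `p + 2` by two new vertices. -/
def closure : SimpleGraph (V ⊕ D × Bool) :=
  SimpleGraph.fromRel fun x y =>
    match x, y with
    | .inl v, .inl w => H.Adj v w
    | .inl v, .inr (d, false) => v = L.leg d (p - 1)
    | .inl v, .inr (d, true) => v = L.leg d 0
    | .inr (d, false), .inr (e, true) => d = e
    | _, _ => False

theorem adj_inl_inl {v w : V} : L.closure.Adj (.inl v) (.inl w) ↔ H.Adj v w := by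
  rw [closure, SimpleGraph.fromRel_adj]
  simp only [ne_eq, Sum.inl.injEq]
  exact ⟨fun h => h.2.elim id SimpleGraph.Adj.symm, fun h => ⟨h.ne, Or.inl h⟩⟩

theorem adj_inl_false {v : V} {d : D} :
    L.closure.Adj (.inl v) (.inr (d, false)) ↔ v = L.leg d (p - 1) := by
  simp [closure]

theorem adj_inl_true {v : V} {d : D} :
    L.closure.Adj (.inl v) (.inr (d, true)) ↔ v = L.leg d 0 := by
  simp [closure]

theorem adj_false_true {d e : D} :
    L.closure.Adj (.inr (d, false)) (.inr (e, true)) ↔ d = e := by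
  simp [closure]

theorem not_adj_inr_same {d e : D} {b : Bool} :
    ¬ L.closure.Adj (.inr (d, b)) (.inr (e, b)) := by
  cases b <;> simp [closure]

/-- The cycle of the closure through the leg `d`. -/
def cyc (d : D) (i : ℕ) : V ⊕ D × Bool :=
  if i < p then .inl (L.leg d i) else if i = p then .inr (d, false)
  else if i = p + 1 then .inr (d, true) else .inl (L.leg d 0)

theorem cyc_of_lt {d : D} {i : ℕ} (h : i < p) : L.cyc d i = .inl (L.leg d i) := if_pos h

theorem cyc_length {d : D} : L.cyc d p = .inr (d, false) := by simp [cyc]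

theorem cyc_length_add_one {d : D} : L.cyc d (p + 1) = .inr (d, true) := by simp [cyc]

theorem cyc_zero {d : D} : L.cyc d 0 = .inl (L.leg d 0) := L.cyc_of_lt L.pos

/-- The default branch of `cyc` closes the cycle. The reversed direction in `turn` reads the
position `p + 2 - i`, so this value makes both directions start at the beginning of the leg. -/
theorem cyc_length_add_two {d : D} : L.cyc d (p + 2) = .inl (L.leg d 0) := by simp [cyc]

theorem cyc_cases {i : ℕ} (hi : i ≤ p + 2) : i < p ∨ i = p ∨ i = p + 1 ∨ i = p + 2 := by omega

theorem cyc_ne_core {d : D} {i : ℕ} (hi : i ≤ p + 2) {c : V} (hc : c ∈ L.core) :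
    L.cyc d i ≠ .inl c := by
  have h0 := L.notMem d 0 L.pos
  rcases cyc_cases hi with h | rfl | rfl | rfl
  · rw [L.cyc_of_lt h]
    have := L.notMem d i h
    rintro ⟨⟩
    exact this hc
  · rw [cyc_length]; simp
  · rw [cyc_length_add_one]; simp
  · rw [cyc_length_add_two]
    rintro ⟨⟩
    exact h0 hc

theorem cyc_inj {d e : D} {i j : ℕ} (hi : i < p + 2) (hj : j < p + 2)
    (h : L.cyc d i = L.cyc e j) : d = e ∧ i = j := by
  rcases cyc_cases hi.le with h1 | rfl | rfl | rfl <;>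
    rcases cyc_cases hj.le with h2 | h2 | h2 | h2 <;> try subst h2
  all_goals first
    | omega
    | (simp_all only [cyc_of_lt, cyc_length, cyc_length_add_one, Sum.inl.injEq, Sum.inr.injEq,
        Prod.mk.injEq, and_true, reduceCtorEq, and_false])
  exact L.inj _ _ _ _ h1 h2 h

theorem adj_zero_iff {d : D} {x : V ⊕ D × Bool} : L.closure.Adj (.inl (L.leg d 0)) x ↔
    x = .inl (L.root d) ∨ x = L.cyc d 1 ∨ x = L.cyc d (p + 1) := by
  have hp := L.pos
  rw [cyc_length_add_one]
  rcases x with v | ⟨e, _ | _⟩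
  · rw [adj_inl_inl, L.adj_zero]
    by_cases h : 1 < p
    · simp [L.cyc_of_lt h, h]
    · obtain rfl : p = 1 := by omega
      simp [cyc_length]
  · rw [adj_inl_false]
    by_cases h : 1 < p
    · simp only [L.cyc_of_lt h, reduceCtorEq, Sum.inr.injEq, Prod.mk.injEq, Bool.false_eq_true,
        and_false, or_self, iff_false]
      intro h'
      have := (L.inj _ _ _ _ hp (by omega) h').2
      omega
    · obtain rfl : p = 1 := by omega
      simp only [cyc_length, reduceCtorEq, Sum.inr.injEq, Prod.mk.injEq, and_true,
        Bool.false_eq_true, and_false, or_false, false_or]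
      exact ⟨fun h => (L.inj _ _ _ _ hp hp h).1.symm, fun h => by rw [h]⟩
  · rw [adj_inl_true]
    have h1 : L.cyc d 1 ≠ .inr (e, true) := by
      by_cases h : 1 < p
      · simp [L.cyc_of_lt h]
      · obtain rfl : p = 1 := by omega
        simp [cyc_length]
    simp only [reduceCtorEq, h1.symm, Sum.inr.injEq, Prod.mk.injEq, and_true, false_or]
    exact ⟨fun h => (L.inj _ _ _ _ hp hp h).1.symm, fun h => by rw [h]⟩

theorem adj_cyc {d : D} {i : ℕ} (hi : i < p + 1) {x : V ⊕ D × Bool} :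
    L.closure.Adj (L.cyc d (i + 1)) x ↔ x = L.cyc d i ∨ x = L.cyc d (i + 2) := by
  have hp := L.pos
  rcases (by omega : i + 1 < p ∨ i + 1 = p ∨ i = p) with h | h | rfl
  · rw [L.cyc_of_lt h, L.cyc_of_lt (by omega : i < p)]
    rcases x with v | ⟨e, _ | _⟩
    · rw [adj_inl_inl, L.adj_succ _ _ h]
      by_cases h2 : i + 2 < p
      · simp [L.cyc_of_lt h2, h2]
      · obtain rfl : p = i + 2 := by omega
        simp [cyc_length]
    · rw [adj_inl_false]
      by_cases h2 : i + 2 < p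
      · simp only [L.cyc_of_lt h2, reduceCtorEq, or_self, iff_false]
        intro h'
        have := (L.inj _ _ _ _ h (by omega) h').2
        omega
      · obtain rfl : p = i + 2 := by omega
        simp only [cyc_length, reduceCtorEq, Sum.inr.injEq, Prod.mk.injEq, and_true, false_or]
        exact ⟨fun h' => (L.inj _ _ _ _ h (by omega) h').1.symm, fun h => by rw [h]; rfl⟩
    · rw [adj_inl_true]
      have h1 : L.cyc d (i + 2) ≠ .inr (e, true) := by
        by_cases h2 : i + 2 < p
        · simp [L.cyc_of_lt h2]
        · obtain rfl : p = i + 2 := by omega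
          simp [cyc_length]
      simp only [reduceCtorEq, h1.symm, or_self, iff_false]
      intro h'
      have := (L.inj _ _ _ _ h hp h').2
      omega
  · subst h
    rw [cyc_length, cyc_length_add_one, L.cyc_of_lt (by omega)]
    rcases x with v | ⟨e, _ | _⟩
    · rw [SimpleGraph.adj_comm, adj_inl_false]; simp
    · simp [not_adj_inr_same]
    · rw [adj_false_true]; simp [eq_comm]
  · rw [cyc_length, cyc_length_add_one, cyc_length_add_two]
    rcases x with v | ⟨e, _ | _⟩
    · rw [SimpleGraph.adj_comm, adj_inl_true]; simp
    · rw [SimpleGraph.adj_comm, adj_false_true]; simp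
    · simp [not_adj_inr_same]

theorem adj_core {c : V} (hc : c ∈ L.core) {x : V ⊕ D × Bool} :
    L.closure.Adj (.inl c) x ↔ ∃ v, H.Adj c v ∧ x = .inl v := by
  rcases x with v | ⟨e, _ | _⟩
  · simp [adj_inl_inl]
  · have := L.notMem e (p - 1) (by have := L.pos; omega)
    rw [adj_inl_false]
    simp only [reduceCtorEq, and_false, exists_false, iff_false]
    rintro rfl
    exact this hc
  · have := L.notMem e 0 L.pos
    rw [adj_inl_true]
    simp only [reduceCtorEq, and_false, exists_false, iff_false]
    rintro rfl
    exact this hc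

theorem ne_of_adj_core {c v w : V} (hc : c ∈ L.core) (h : ∀ w', H.Adj v w' ↔ w' = w) : v ≠ c := by
  rintro rfl
  have h3 := L.ncard_core v hc
  have : H.neighborSet v = {w} := by ext x; simp [h]
  rw [this, Set.ncard_singleton] at h3
  omega

theorem adj_leg_core {d : D} {i : ℕ} (hi : i < p) {c : V} (hc : c ∈ L.core)
    (h : H.Adj (L.leg d i) c) : i = 0 ∧ c = L.root d := by
  rcases i with _ | i
  · rw [L.adj_zero] at h
    rcases h with rfl | ⟨h1, rfl⟩
    · simp
    · exact absurd hc (L.notMem d 1 h1)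
  · rw [L.adj_succ _ _ hi] at h
    rcases h with rfl | ⟨h1, rfl⟩
    · exact absurd hc (L.notMem d i (by omega))
    · exact absurd hc (L.notMem d _ h1)

theorem leg_not_isPlain {d : D} {i : ℕ} (hi : i < p) : ¬ L.IsPlain (L.leg d i) := by
  rintro ⟨hp, c, hc, h⟩
  obtain ⟨rfl, -⟩ := L.adj_leg_core hi hc ((h c).2 rfl)
  have := (h (L.leg d 1)).1 ((L.adj_zero _ _).2 (Or.inr ⟨hp, rfl⟩))
  exact L.notMem d 1 hp (this ▸ hc)

theorem adj_plain {v c : V} (hp : 1 < p) (hc : c ∈ L.core) (h : ∀ w, H.Adj v w ↔ w = c)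
    {x : V ⊕ D × Bool} : L.closure.Adj (.inl v) x ↔ x = .inl c := by
  have hv : ∀ d, ∀ i < p, v ≠ L.leg d i := by
    rintro d i hi rfl
    exact L.leg_not_isPlain hi ⟨hp, c, hc, h⟩
  rcases x with v | ⟨e, _ | _⟩
  · simp [adj_inl_inl, h]
  · rw [adj_inl_false]; simp [hv e (p - 1) (by omega)]
  · rw [adj_inl_true]; simp [hv e 0 (by omega)]

/-- The two ways to run through the cycle of the leg `d`. -/
def turn (d : D) (b : Bool) (i : ℕ) : V ⊕ D × Bool :=
  bif b then L.cyc d i else L.cyc d (p + 2 - i)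

theorem turn_zero {d : D} {b : Bool} : L.turn d b 0 = .inl (L.leg d 0) := by
  cases b
  · exact L.cyc_length_add_two
  · exact L.cyc_zero

theorem turn_length_add_two {d : D} {b : Bool} : L.turn d b (p + 2) = .inl (L.leg d 0) := by
  cases b
  · simp [turn, cyc_zero]
  · exact L.cyc_length_add_two

theorem turn_ne_core {d : D} {b : Bool} {i : ℕ} (hi : i ≤ p + 2) {c : V} (hc : c ∈ L.core) :
    L.turn d b i ≠ .inl c := by
  cases b
  · exact L.cyc_ne_core (by omega) hc
  · exact L.cyc_ne_core hi hc

theorem adj_turn {d : D} {b : Bool} {i : ℕ} (hi : i < p + 1) {x : V ⊕ D × Bool} :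
    L.closure.Adj (L.turn d b (i + 1)) x ↔ x = L.turn d b i ∨ x = L.turn d b (i + 2) := by
  cases b
  · simp only [turn, cond_false]
    have h1 : p + 2 - (i + 1) = p - i + 1 := by omega
    have h2 : p + 2 - (i + 2) = p - i := by omega
    have h3 : p + 2 - i = p - i + 2 := by omega
    rw [h1, h2, h3, L.adj_cyc (by omega), or_comm]
  · exact L.adj_cyc hi

theorem turn_fst_inj {d e : D} {b b' : Bool} {i j : ℕ} (hi : i ≤ p + 2) (hj : j ≤ p + 2)
    (h : L.turn d b i = L.turn e b' j) : d = e := by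
  have key : ∀ i j, i ≤ p + 2 → j ≤ p + 2 → L.cyc d i = L.cyc e j → d = e := by
    intro i j hi hj h
    wlog hi' : i < p + 2 generalizing i
    · refine this 0 (by omega) ?_ (by omega)
      obtain rfl : i = p + 2 := by omega
      rw [← h, cyc_length_add_two, cyc_zero]
    wlog hj' : j < p + 2 generalizing j
    · refine this 0 (by omega) ?_ (by omega)
      obtain rfl : j = p + 2 := by omega
      rw [h, cyc_length_add_two, cyc_zero]
    exact (L.cyc_inj hi' hj' h).1
  cases b <;> cases b' <;> exact key _ _ (by omega) (by omega) h

/-- The bounds exclude the ends because the positions `0` and `p + 2` are the same vertex. -/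
theorem turn_inj {d e : D} {b : Bool} {i j : ℕ} (hi0 : 0 < i) (hi : i < p + 2) (hj0 : 0 < j)
    (hj : j < p + 2) (h : L.turn d b i = L.turn e b j) : i = j := by
  cases b
  · have := (L.cyc_inj (by omega) (by omega) h).2
    omega
  · exact (L.cyc_inj hi hj h).2

theorem adj_zero_iff_turn {d : D} {x : V ⊕ D × Bool} : L.closure.Adj (.inl (L.leg d 0)) x ↔
    x = .inl (L.root d) ∨ ∃ b, x = L.turn d b 1 := by
  rw [adj_zero_iff]
  simp [turn, or_comm]

end LegDecomposition

/-! ### Embeddings into the closure -/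

namespace LegDecomposition

section

variable {V D : Type} {H : SimpleGraph V} {p : ℕ} {L : LegDecomposition H D p}
  {f : H ↪g L.closure}

theorem ncard_pair_le {α : Type*} (x y : α) : ({x, y} : Set α).ncard ≤ 2 :=
  (Set.ncard_insert_le _ _).trans (by rw [Set.ncard_singleton])

/-- The three neighbours of `c` have distinct images in `T`, so they exhaust it. This turns a degree
bound into surjectivity. -/
theorem exists_adj_of_subset {c : V} (hc : c ∈ L.core) {T : Set (V ⊕ D × Bool)}
    (hfin : T.Finite) (hT : T.ncard ≤ 3) (hadj : ∀ x, L.closure.Adj (f c) x → x ∈ T) :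
    ∀ z ∈ T, ∃ y, H.Adj c y ∧ f y = z := by
  have h1 : f '' H.neighborSet c ⊆ T := by
    rintro _ ⟨y, hy, rfl⟩
    exact hadj _ (f.map_rel_iff.2 hy)
  have h2 : (f '' H.neighborSet c).ncard = 3 := by
    rw [Set.ncard_image_of_injective _ f.injective, L.ncard_core c hc]
  intro z hz
  rw [← Set.eq_of_subset_of_ncard_le h1 (by omega) hfin] at hz
  exact hz

theorem not_subset_pair {c : V} (hc : c ∈ L.core) {x y : V ⊕ D × Bool}
    (hadj : ∀ z, L.closure.Adj (f c) z → z = x ∨ z = y) : False := by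
  have h1 : f '' H.neighborSet c ⊆ {x, y} := by
    rintro _ ⟨z, hz, rfl⟩
    exact hadj _ (f.map_rel_iff.2 hz)
  have h2 : (f '' H.neighborSet c).ncard = 3 := by
    rw [Set.ncard_image_of_injective _ f.injective, L.ncard_core c hc]
  have := (Set.ncard_le_ncard h1).trans (ncard_pair_le x y)
  omega

theorem core_ne_turn {c : V} (hc : c ∈ L.core) {d : D} {b : Bool} {i : ℕ} (hi : i < p + 1) :
    f c ≠ L.turn d b (i + 1) := by
  intro h
  refine not_subset_pair (f := f) hc (x := L.turn d b i) (y := L.turn d b (i + 2)) ?_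
  intro z hz
  rwa [h, L.adj_turn hi] at hz

/-- All other vertices of the closure have at most two neighbours: on the cycles only the start of
the leg has a third one, its root. -/
theorem core_or_leg {c : V} (hc : c ∈ L.core) :
    (∃ c' ∈ L.core, f c = .inl c') ∨ ∃ d, f c = .inl (L.leg d 0) := by
  rcases h : f c with v | ⟨d, _ | _⟩
  · rcases L.cover v with hv | ⟨d, i, hi, rfl⟩ | ⟨hp, c', hc', hv⟩
    · exact Or.inl ⟨v, hv, rfl⟩
    · rcases i with _ | i
      · exact Or.inr ⟨d, rfl⟩
      · rw [← L.cyc_of_lt hi] at h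
        exact absurd h (core_ne_turn (b := true) hc (by omega))
    · refine (not_subset_pair (f := f) hc (x := .inl c') (y := .inl c') fun z hz => ?_).elim
      rw [h, L.adj_plain hp hc' hv] at hz
      exact Or.inl hz
  · have h1 : f c = L.turn d true (p - 1 + 1) := by
      rw [h, Nat.sub_add_cancel L.pos]; exact L.cyc_length.symm
    exact absurd h1 (core_ne_turn hc (by omega))
  · have h1 : f c = L.turn d true (p + 1) := by
      rw [h]; exact L.cyc_length_add_one.symm
    exact absurd h1 (core_ne_turn hc (by omega))

/-- Inner vertices of a cycle have degree two, so an injective image that has entered the cycle must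
keep its direction. -/
theorem follow {x y z : V} {d : D} {b : Bool} {i : ℕ} (hi : i < p + 1) (hx : f x = L.turn d b i)
    (hy : f y = L.turn d b (i + 1)) (hyz : H.Adj y z) (hxz : z ≠ x) :
    f z = L.turn d b (i + 2) := by
  have h := f.map_rel_iff.2 hyz
  rw [hy, L.adj_turn hi, ← hx] at h
  exact h.resolve_left fun h => hxz (f.injective h)

theorem adj_leg_succ {d : D} {i : ℕ} (hi : i + 1 < p) : H.Adj (L.leg d i) (L.leg d (i + 1)) := by
  rw [SimpleGraph.adj_comm, L.adj_succ _ _ hi]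
  exact Or.inl rfl

/-- If `y` were the start of a leg, the `p` leg vertices would fill the positions `1, …, p` of the
cycle. The end of the leg would then be adjacent to `y'`, which sits at `p + 1`; but the only
neighbour of that end is `c` if `p = 1` and its predecessor in the leg otherwise, and neither can be
`y'`. -/
theorem isPlain_of_turn {c y y' : V} {d : D} {b : Bool} (hc : c ∈ L.core)
    (hfc : f c = .inl (L.leg d 0)) (hcy : H.Adj c y) (hcy' : H.Adj c y') (hy : f y = L.turn d b 1)
    (hy' : f y' = L.turn d b (p + 1)) : L.IsPlain y := by
  rcases L.cover y with h | ⟨e, i, hi, rfl⟩ | h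
  · exact absurd hy (core_ne_turn (i := 0) h (by omega))
  · obtain ⟨rfl, rfl⟩ := L.adj_leg_core hi hc hcy.symm
    have hleg : ∀ i < p, f (L.leg e i) = L.turn d b (i + 1) := by
      intro i
      induction i using Nat.strong_induction_on with
      | _ i ih =>
        intro hi
        rcases i with _ | _ | i
        · exact hy
        · refine follow (by omega) (hfc.trans L.turn_zero.symm) hy (adj_leg_succ hi) ?_
          intro h
          exact L.notMem e 1 hi (h ▸ hc)
        · refine follow (by omega) (ih i (by omega) (by omega)) (ih (i + 1) (by omega) (by omega))
            (adj_leg_succ hi) fun h => ?_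
          have := (L.inj _ _ _ _ hi (by omega) h).2
          omega
    have hp := L.pos
    have hlast := hleg (p - 1) (by omega)
    rw [Nat.sub_add_cancel hp] at hlast
    have hadj : H.Adj (L.leg e (p - 1)) y' := by
      rw [← f.map_rel_iff, hlast, hy']
      have := L.adj_turn (d := d) (b := b) (i := p - 1) (by omega) (x := L.turn d b (p + 1))
      rw [Nat.sub_add_cancel hp, show p - 1 + 2 = p + 1 by omega] at this
      exact this.2 (Or.inr rfl)
    rcases (by omega : p = 1 ∨ 1 < p) with h1 | h1
    · rw [show p - 1 = 0 by omega, L.adj_zero] at hadj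
      rcases hadj with rfl | ⟨h2, -⟩
      · exact absurd hcy' (H.loopless.irrefl _)
      · omega
    · rw [show p - 1 = p - 2 + 1 by omega, L.adj_succ _ _ (by omega)] at hadj
      rcases hadj with rfl | ⟨h2, -⟩
      · obtain ⟨h2, -⟩ := L.adj_leg_core (by omega) hc hcy'.symm
        rw [h2, hy] at hy'
        have := L.turn_inj (by omega) (by omega) (by omega) (by omega) hy'
        omega
      · omega
  · exact h

theorem isCherry_of_leg {c : V} {d : D} (hc : c ∈ L.core) (hfc : f c = .inl (L.leg d 0)) :
    L.IsCherry c := by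
  have hp := L.pos
  have h := exists_adj_of_subset (f := f) hc
    (T := {.inl (L.root d), L.cyc d 1, L.cyc d (p + 1)}) (Set.toFinite _)
    ((Set.ncard_insert_le _ _).trans (Nat.succ_le_succ (ncard_pair_le _ _))) (fun x hx => by
      rw [hfc, L.adj_zero_iff] at hx
      simpa using hx)
  obtain ⟨y, hcy, hy⟩ := h (L.cyc d 1) (by simp)
  obtain ⟨y', hcy', hy'⟩ := h (L.cyc d (p + 1)) (by simp)
  refine ⟨y, y', ?_, ?_, ?_, hcy, hcy'⟩
  · rintro rfl
    have := (L.cyc_inj (by omega) (by omega) (hy.symm.trans hy')).2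
    omega
  · exact isPlain_of_turn (b := true) hc hfc hcy hcy' hy hy'
  -- The same argument with the cycle traversed in the opposite direction.
  · refine isPlain_of_turn (d := d) (b := false) hc hfc hcy' hcy ?_ ?_
    · rw [hy']; rfl
    · rw [hy, turn, cond_false, show p + 2 - (p + 1) = 1 by omega]

/-- Around every vertex with two leaves there is a core vertex that prevents it from being mapped
to the first vertex of a leg. -/
def GoodCherries (L : LegDecomposition H D p) : Prop :=
  ∀ c ∈ L.core, L.IsCherry c → ∃ w ∈ L.core, H.Adj c w ∧
    (∀ c', H.Adj w c' → c' ∈ L.core ∧ (c' ≠ c → ¬ L.IsCherry c')) ∧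
    ∀ d, ∃ d', d' ≠ d ∧ L.root d' = L.root d

variable [Finite V]

/-- A core vertex mapped to the start of a leg is a cherry, and its neighbour `w` from
`GoodCherries` must go to the root of that leg. A second leg at that root has its start hit by
another neighbour of `w`, which would then be a cherry as well. -/
theorem core_to_core (hL : L.GoodCherries) {c : V} (hc : c ∈ L.core) :
    ∃ c' ∈ L.core, f c = .inl c' := by
  refine core_or_leg hc |>.resolve_right ?_
  rintro ⟨d, hfc⟩
  have hp := L.pos
  obtain ⟨w, hw, hcw, hnbr, htwo⟩ := hL c hc (isCherry_of_leg hc hfc)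
  have hfw := f.map_rel_iff.2 hcw
  rw [hfc, L.adj_zero_iff_turn] at hfw
  rcases hfw with hfw | ⟨b, hfw⟩
  · obtain ⟨d', hd', hroot⟩ := htwo d
    have h := exists_adj_of_subset (f := f) hw (T := Sum.inl '' H.neighborSet (L.root d))
      (Set.toFinite _)
      (by rw [Set.ncard_image_of_injective _ Sum.inl_injective, L.ncard_core _ (L.root_mem d)])
      (fun x hx => by
        rw [hfw, L.adj_core (L.root_mem d)] at hx
        obtain ⟨v, hv, rfl⟩ := hx
        exact ⟨v, hv, rfl⟩)
    obtain ⟨c', hwc', hc'⟩ := h (.inl (L.leg d' 0)) ⟨_, by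
      rw [SimpleGraph.mem_neighborSet, SimpleGraph.adj_comm, L.adj_zero]
      exact Or.inl hroot.symm, rfl⟩
    obtain ⟨h1, h2⟩ := hnbr c' hwc'
    refine h2 ?_ (isCherry_of_leg h1 hc')
    rintro rfl
    rw [hfc] at hc'
    exact hd' (L.inj _ _ _ _ hp hp (Sum.inl_injective hc')).1.symm
  · exact core_ne_turn (i := 0) hw (by omega) hfw

/-- The core is finite and mapped injectively into itself, hence onto itself. -/
theorem exists_core (hL : L.GoodCherries) (f : H ↪g L.closure) {c' : V} (hc' : c' ∈ L.core) :
    ∃ c ∈ L.core, f c = .inl c' := by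
  choose g hg hfg using fun c : L.core => core_to_core (f := f) hL c.2
  have hinj : Function.Injective fun c : L.core => (⟨g c, hg c⟩ : L.core) := by
    intro c₁ c₂ h
    have h1 : g c₁ = g c₂ := congrArg Subtype.val h
    exact Subtype.ext (f.injective (by rw [hfg, hfg, h1]))
  obtain ⟨c, hc⟩ := Finite.surjective_of_injective hinj ⟨c', hc'⟩
  exact ⟨c, c.2, by rw [hfg]; exact congrArg Sum.inl (congrArg Subtype.val hc)⟩

/-- The image is a neighbour of a core vertex but not in the core, which is already filled by images
of core vertices. It is not a plain leaf either: these occur only for `p > 1`, when the start of a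
leg has a second neighbour. -/
theorem exists_leg (hL : L.GoodCherries) (f : H ↪g L.closure) (d : D) :
    ∃ e, f (L.root d) = .inl (L.root e) ∧ f (L.leg d 0) = .inl (L.leg e 0) := by
  have hp := L.pos
  obtain ⟨c', hc', hfr⟩ := core_to_core (f := f) hL (L.root_mem d)
  have hadj : H.Adj (L.leg d 0) (L.root d) := (L.adj_zero _ _).2 (Or.inl rfl)
  have h1 := f.map_rel_iff.2 hadj.symm
  rw [hfr, L.adj_core hc'] at h1
  obtain ⟨x, hx, hfx⟩ := h1
  rcases L.cover x with h | ⟨e, i, hi, rfl⟩ | ⟨hp1, c'', hc'', h⟩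
  · obtain ⟨c, hc, hfc⟩ := exists_core hL f h
    have := f.injective (hfc.trans hfx.symm)
    exact absurd (this ▸ hc) (L.notMem d 0 hp)
  · obtain ⟨rfl, rfl⟩ := L.adj_leg_core hi hc' hx.symm
    exact ⟨e, hfr, hfx⟩
  · have h2 := f.map_rel_iff.2 (adj_leg_succ (L := L) (d := d) (i := 0) (by omega))
    have h3 := f.map_rel_iff.2 hadj
    rw [hfx, L.adj_plain hp1 hc'' h] at h2 h3
    have := f.injective (h2.trans h3.symm)
    exact absurd (this ▸ L.root_mem d) (L.notMem d 1 hp1)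

theorem exists_turn (hL : L.GoodCherries) (f : H ↪g L.closure) (d : D) :
    ∃ e b, ∀ i < p, f (L.leg d i) = L.turn e b i := by
  have hp := L.pos
  obtain ⟨e, hr, h0⟩ := exists_leg hL f d
  rcases (by omega : p = 1 ∨ 1 < p) with h1 | h1
  · refine ⟨e, true, fun i hi => ?_⟩
    obtain rfl : i = 0 := by omega
    rw [h0, turn_zero]
  · have h2 := f.map_rel_iff.2 (adj_leg_succ (L := L) (d := d) (i := 0) (by omega))
    rw [h0, L.adj_zero_iff_turn, ← hr] at h2
    rcases h2 with h2 | ⟨b, h2⟩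
    · exact absurd (f.injective h2 ▸ L.root_mem d) (L.notMem d 1 h1)
    · refine ⟨e, b, fun i => ?_⟩
      induction i using Nat.strong_induction_on with
      | _ i ih =>
        intro hi
        rcases i with _ | _ | i
        · rw [h0, turn_zero]
        · exact h2
        · refine follow (by omega) (ih i (by omega) (by omega)) (ih (i + 1) (by omega) (by omega))
            (adj_leg_succ hi) fun h => ?_
          have := (L.inj _ _ _ _ hi (by omega) h).2
          omega

/-- Every copy of `H` in the closure omits the last two vertices of each of the cycles. -/
theorem exists_turn_notMem (hL : L.GoodCherries) (f : H ↪g L.closure) (d : D) :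
    ∃ e b, (∀ i < p, f (L.leg d i) = L.turn e b i) ∧
      ∀ i, p ≤ i → i < p + 2 → L.turn e b i ∉ Set.range f := by
  have hp := L.pos
  obtain ⟨e, b, h⟩ := exists_turn hL f d
  refine ⟨e, b, h, ?_⟩
  rintro i hi1 hi2 ⟨x, hx⟩
  -- The omitted positions `p` and `p + 1` have no neighbours in the core, so a preimage could only
  -- be a non-initial leg vertex. That leg would have to run around the same cycle, hence be the leg
  -- `d` itself, whose vertices only reach the position `p - 1`.
  have hcore : ∀ c ∈ L.core, ¬ H.Adj x c := by
    intro c hc hadj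
    obtain ⟨c', hc', hfc⟩ := core_to_core (f := f) hL hc
    have h1 := f.map_rel_iff.2 hadj
    rw [hx, hfc, show i = i - 1 + 1 by omega, L.adj_turn (by omega)] at h1
    rcases h1 with h1 | h1
    · exact L.turn_ne_core (by omega) hc' h1.symm
    · exact L.turn_ne_core (by omega) hc' h1.symm
  rcases L.cover x with hc | ⟨d', j, hj, rfl⟩ | ⟨-, c, hc, hxc⟩
  · rw [show i = i - 1 + 1 by omega] at hx
    exact core_ne_turn hc (by omega) hx
  · rcases j with _ | j
    · exact hcore _ (L.root_mem d') ((L.adj_zero _ _).2 (Or.inl rfl))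
    · obtain ⟨e', b', h'⟩ := exists_turn hL f d'
      have h1 := (h' _ hj).symm.trans hx
      obtain rfl := L.turn_fst_inj (by omega) (by omega) h1
      have h2 := (h' 0 hp).trans (L.turn_zero.trans (L.turn_zero.symm.trans (h 0 hp).symm))
      obtain rfl := (L.inj _ _ _ _ hp hp (f.injective h2)).1
      have h3 := (h _ hj).symm.trans hx
      have := L.turn_inj (by omega) (by omega) (by omega) (by omega) h3
      omega
  · exact hcore c hc ((hxc c).2 rfl)

end

/-- A graph with a leg decomposition, rooted at the end of a leg and at the beginning of a
different leg, is not inherent. -/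
theorem not_isInherent {V D : Type} [Finite V] [Finite D] {H : SimpleGraph V} {p : ℕ}
    (L : LegDecomposition H D p) (hL : L.GoodCherries) {d₁ d₂ : D} (hd : d₁ ≠ d₂) :
    ¬ (TwoRooted.mk H (L.leg d₁ (p - 1)) (L.leg d₂ 0)).IsInherent := by
  refine TwoRooted.not_isInherent_of_confining L.closure
    ⟨⟨⟨Sum.inl, Sum.inl_injective⟩, L.adj_inl_inl⟩⟩ fun (f : H ↪g L.closure) => ?_
  have hp := L.pos
  change ∃ s' t', IsExtension L.closure (Set.range f) (f (L.leg d₁ (p - 1))) (f (L.leg d₂ 0)) s' t' ∧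
    ¬ IsClosable L.closure (Set.range f) s' t'
  obtain ⟨e₁, b₁, h1, hn1⟩ := exists_turn_notMem hL f d₁
  obtain ⟨e₂, b₂, h2, hn2⟩ := exists_turn_notMem hL f d₂
  have he : e₁ ≠ e₂ := by
    rintro rfl
    have h3 := (h1 0 hp).trans (L.turn_zero.trans (L.turn_zero.symm.trans (h2 0 hp).symm))
    exact hd (L.inj _ _ _ _ hp hp (f.injective h3)).1
  have hadj1 : ∀ x, L.closure.Adj (L.turn e₁ b₁ p) x ↔
      x = f (L.leg d₁ (p - 1)) ∨ x = L.turn e₁ b₁ (p + 1) := by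
    intro x
    have := L.adj_turn (d := e₁) (b := b₁) (i := p - 1) (by omega) (x := x)
    rwa [Nat.sub_add_cancel hp, show p - 1 + 2 = p + 1 by omega,
      ← h1 (p - 1) (by omega)] at this
  have hadj2 : ∀ e b x, L.closure.Adj (L.turn e b (p + 1)) x ↔
      x = L.turn e b p ∨ x = .inl (L.leg e 0) := by
    intro e b x
    rw [L.adj_turn (by omega), turn_length_add_two]
  have hf : ∀ {d e b}, (∀ i < p, f (L.leg d i) = L.turn e b i) →
      f (L.leg d 0) = .inl (L.leg e 0) := fun h => (h 0 hp).trans L.turn_zero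
  have hne : L.turn e₁ b₁ p ≠ L.turn e₂ b₂ (p + 1) :=
    fun h => he (L.turn_fst_inj (by omega) (by omega) h)
  have hnadj : ¬ L.closure.Adj (L.turn e₁ b₁ p) (L.turn e₂ b₂ (p + 1)) := by
    rw [hadj1, h1 _ (by omega)]
    rintro (h | h)
    · exact he (L.turn_fst_inj (by omega) (by omega) h).symm
    · exact he (L.turn_fst_inj (by omega) (by omega) h).symm
  refine ⟨L.turn e₁ b₁ p, L.turn e₂ b₂ (p + 1), ⟨hn1 _ (by omega) (by omega),
    hn2 _ (by omega) (by omega), hne, hnadj, fun v hv => ?_, fun v hv => ?_⟩,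
    not_isClosable_of_nbrs hne hnadj fun z hz => ?_⟩
  · rw [hadj1]
    exact or_iff_left fun h => hn1 (p + 1) (by omega) (by omega) (h ▸ hv)
  · rw [hadj2, hf h2]
    exact or_iff_right fun h => hn2 p (by omega) (by omega) (h ▸ hv)
  -- The neighbours of `s'` are the end of the leg and the other omitted vertex of the cycle, which
  -- is adjacent to the start of that leg.
  · rw [hadj1] at hz
    rcases hz with rfl | rfl
    · exact Or.inl ⟨_, rfl⟩
    · refine Or.inr ⟨_, ⟨L.leg d₁ 0, rfl⟩, ?_⟩
      rw [SimpleGraph.adj_comm, hadj2, hf h1]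
      exact Or.inr rfl

theorem ncard_leg_zero {V D : Type} {H : SimpleGraph V} (L : LegDecomposition H D 2) (d : D) :
    (H.neighborSet (L.leg d 0)).ncard = 2 := by
  have : H.neighborSet (L.leg d 0) = {L.root d, L.leg d 1} := by
    ext x; simp [L.adj_zero]
  rw [this, Set.ncard_pair]
  intro h
  exact L.notMem d 1 (by norm_num) (h ▸ L.root_mem d)

theorem ncard_leg_one {V D : Type} {H : SimpleGraph V} (L : LegDecomposition H D 2) (d : D) :
    (H.neighborSet (L.leg d 1)).ncard = 1 := by
  have : H.neighborSet (L.leg d 1) = {L.leg d 0} := by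
    ext x; simp [L.adj_succ d 0 (by norm_num)]
  rw [this, Set.ncard_singleton]

/-- Case of legs with two vertices, with the roots described by their degrees. -/
theorem not_isInherent_of_ncard {V D : Type} [Finite V] [Finite D] {H : SimpleGraph V}
    (L : LegDecomposition H D 2) (hL : L.GoodCherries) {s t : V} (hs : (H.neighborSet s).ncard = 1)
    (hs' : ¬ L.IsPlain s) (ht : (H.neighborSet t).ncard = 2) (hst : ¬ H.Adj s t) :
    ¬ (TwoRooted.mk H s t).IsInherent := by
  obtain ⟨d₁, rfl⟩ : ∃ d, s = L.leg d 1 := by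
    rcases L.cover s with h | ⟨d, i, hi, rfl⟩ | h
    · rw [L.ncard_core s h] at hs; omega
    · interval_cases i
      · rw [L.ncard_leg_zero] at hs; omega
      · exact ⟨d, rfl⟩
    · exact absurd h hs'
  obtain ⟨d₂, rfl⟩ : ∃ d, t = L.leg d 0 := by
    rcases L.cover t with h | ⟨d, i, hi, rfl⟩ | ⟨-, c, -, h⟩
    · rw [L.ncard_core t h] at ht; omega
    · interval_cases i
      · exact ⟨d, rfl⟩
      · rw [L.ncard_leg_one] at ht; omega
    · have : H.neighborSet t = {c} := by ext x; simp [h]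
      rw [this, Set.ncard_singleton] at ht; omega
  refine L.not_isInherent hL ?_
  rintro rfl
  exact hst ((L.adj_succ d₁ 0 (by norm_num) _).2 (Or.inl rfl))

end LegDecomposition

namespace LegDecomposition

variable {V D : Type} {H : SimpleGraph V} {p : ℕ}

/-- Without plain leaves there are no cherries, so the condition is vacuous. -/
theorem goodCherries_of_cover (L : LegDecomposition H D p)
    (h : ∀ v, v ∈ L.core ∨ ∃ d, ∃ i < p, v = L.leg d i) : L.GoodCherries := by
  rintro c - ⟨y, -, -, hy, -⟩
  rcases h y with h | ⟨d, i, hi, rfl⟩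
  · obtain ⟨-, c, hc, h'⟩ := hy
    exact absurd rfl (L.ne_of_adj_core h h')
  · exact absurd hy (L.leg_not_isPlain hi)

theorem not_isPlain_of_cover (L : LegDecomposition H D p) {v : V}
    (h : v ∈ L.core ∨ ∃ d, ∃ i < p, v = L.leg d i) : ¬ L.IsPlain v := by
  rcases h with h | ⟨d, i, hi, rfl⟩
  · rintro ⟨-, c, hc, h'⟩
    exact absurd rfl (L.ne_of_adj_core h h')
  · exact L.leg_not_isPlain hi

end LegDecomposition

/-! ### Combs of type II -/

/-- The legs of the comb `F(p,q,p)`; if `p = 1`, also the teeth count as legs. -/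
def combLeg (p q : ℕ) (hp : 1 ≤ p) :
    Bool ⊕ {_j : Fin q // p = 1} → ℕ → CombVertex p q p
  -- Legs are numbered outwards from the core, which reverses the order on the initial leg. The
  -- truncated subtraction, and the minimum in the final leg, only affect the irrelevant indices `i
  -- ≥ p`.
  | .inl false, i => .a ⟨p - 1 - i, by omega⟩
  | .inl true, i => .a ⟨min (p + q + i) (p + q + p - 1), by omega⟩
  | .inr j, _ => .b j.1

/-- The core vertices to which the legs of the comb are attached. -/
def combRoot (p q : ℕ) (hp : 1 ≤ p) : Bool ⊕ {_j : Fin q // p = 1} → CombVertex p q p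
  | .inl false => .a ⟨p, by omega⟩
  | .inl true => .a ⟨p + q - 1, by omega⟩
  | .inr j => .a ⟨p + j.1, by omega⟩

theorem comb_a_cover {p q : ℕ} (hp : 1 ≤ p) (k : Fin (p + q + p)) :
    (p ≤ k.val ∧ k.val < p + q) ∨ ∃ d, ∃ i < p, CombVertex.a k = combLeg p q hp d i := by
  rcases (by omega : k.val < p ∨ (p ≤ k.val ∧ k.val < p + q) ∨ p + q ≤ k.val) with h | h | h
  · refine Or.inr ⟨.inl false, p - 1 - k, by omega, ?_⟩
    simp [combLeg, Fin.ext_iff]; omega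
  · exact Or.inl h
  · refine Or.inr ⟨.inl true, k - (p + q), by omega, ?_⟩
    simp [combLeg, Fin.ext_iff]; omega

/-- The core of the comb consists of the vertices with teeth. -/
def combLegs (p q : ℕ) (hp : 1 ≤ p) (hq : 1 ≤ q) :
    LegDecomposition (comb p q p) (Bool ⊕ {_j : Fin q // p = 1}) p where
  core := {v | ∃ i : Fin (p + q + p), p ≤ i.val ∧ i.val < p + q ∧ v = .a i}
  root := combRoot p q hp
  leg := combLeg p q hp
  pos := hp
  ncard_core := by
    rintro _ ⟨i, h1, h2, rfl⟩
    rw [Set.ncard_eq_three]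
    refine ⟨.a ⟨i - 1, by omega⟩, .a ⟨i + 1, by omega⟩, .b ⟨i - p, by omega⟩, ?_, by simp, by simp,
      ?_⟩
    · simp only [ne_eq, CombVertex.a.injEq, Fin.mk.injEq]; omega
    · ext v
      rcases v with k | j
      · simp [Fin.ext_iff]; omega
      · simp [Fin.ext_iff]; omega
  root_mem := by
    rintro ((_ | _) | j)
    · exact ⟨_, le_rfl, by simp only; omega, rfl⟩
    · exact ⟨_, by simp only; omega, by simp only; omega, rfl⟩
    · exact ⟨_, by simp only; omega, by simp only; omega, rfl⟩
  adj_zero := by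
    rintro ((_ | _) | ⟨j, h⟩) (k | k) <;> simp [combLeg, combRoot, Fin.ext_iff] <;> omega
  adj_succ := by
    rintro ((_ | _) | ⟨j, h⟩) i hi (k | k) <;> simp [combLeg, Fin.ext_iff] <;> omega
  inj := by
    rintro ((_ | _) | ⟨j, h⟩) ((_ | _) | ⟨j', h'⟩) i i' hi hi' <;>
      simp [combLeg, Fin.ext_iff] <;> omega
  notMem := by
    rintro ((_ | _) | ⟨j, h⟩) i hi ⟨k, h1, h2, h3⟩ <;> simp [combLeg, Fin.ext_iff] at h3 <;> omega
  cover := by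
    rintro (k | j)
    · rcases comb_a_cover hp k with h | h
      · exact Or.inl ⟨k, h.1, h.2, rfl⟩
      · exact Or.inr (Or.inl h)
    · rcases (by omega : p = 1 ∨ 1 < p) with h | h
      · exact Or.inr (Or.inl ⟨.inr ⟨j, h⟩, 0, by omega, rfl⟩)
      · refine Or.inr (Or.inr ⟨h, _, ⟨⟨p + j, by omega⟩, by simp, by simp, rfl⟩, ?_⟩)
        rintro (k | k) <;> simp [Fin.ext_iff]

/-- Only teeth can be plain, and no path vertex has two teeth, so there are no cherries. -/
theorem combLegs_goodCherries (p q : ℕ) (hp : 1 ≤ p) (hq : 1 ≤ q) :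
    (combLegs p q hp hq).GoodCherries := by
  have hb : ∀ v, (combLegs p q hp hq).IsPlain v → ∃ j, v = .b j := by
    rintro (k | j) h
    · refine absurd h (LegDecomposition.not_isPlain_of_cover _ ?_)
      rcases comb_a_cover hp k with h | h
      · exact Or.inl ⟨k, h.1, h.2, rfl⟩
      · exact Or.inr h
    · exact ⟨j, rfl⟩
  rintro _ ⟨i, h1, h2, rfl⟩ ⟨y, y', hne, hy, hy', hadj, hadj'⟩
  obtain ⟨j, rfl⟩ := hb y hy
  obtain ⟨j', rfl⟩ := hb y' hy'
  rw [comb_adj_a_b] at hadj hadj'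
  refine absurd ?_ hne
  rw [CombVertex.b.injEq, Fin.ext_iff]
  omega

instance {p q r : ℕ} : Finite (CombVertex p q r) :=
  Finite.of_surjective (Sum.elim CombVertex.a CombVertex.b) (by
    rintro (i | j)
    exacts [⟨.inl i, rfl⟩, ⟨.inr j, rfl⟩])

theorem not_isInherent_T₂ (p q : ℕ) (hp : 1 ≤ p) (hq : 1 ≤ q) : ¬ (T₂ p q hp).IsInherent := by
  have h := (combLegs p q hp hq).not_isInherent (combLegs_goodCherries p q hp hq)
    (d₁ := .inl false) (d₂ := .inl true) (by simp)
  have h1 : (combLegs p q hp hq).leg (.inl false) (p - 1) = (T₂ p q hp).s := by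
    simp [combLegs, combLeg, T₂]
  have h2 : (combLegs p q hp hq).leg (.inl true) 0 = (T₂ p q hp).t := by
    simp [combLegs, combLeg, T₂, Fin.ext_iff]; omega
  rw [h1, h2] at h
  exact h

/-! ### Leaf-extended full trees -/

section

variable {U : Type} {F : SimpleGraph U}

theorem leafExtend_adj_inl_inl {u v : U} :
    (leafExtend F).Adj (.inl u) (.inl v) ↔ F.Adj u v := by
  rw [leafExtend, SimpleGraph.fromRel_adj]
  simp only [ne_eq, Sum.inl.injEq]
  exact ⟨fun h => h.2.elim id SimpleGraph.Adj.symm, fun h => ⟨h.ne, Or.inl h⟩⟩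

theorem leafExtend_adj_inl_inr {u : U} {v} : (leafExtend F).Adj (.inl u) (.inr v) ↔ u = v.val := by
  simp [leafExtend]

theorem leafExtend_adj_inr_inl {u : U} {v} : (leafExtend F).Adj (.inr v) (.inl u) ↔ u = v.val := by
  simp [leafExtend]

theorem leafExtend_not_adj_inr_inr {u v} : ¬ (leafExtend F).Adj (.inr u) (.inr v) := by
  simp [leafExtend]

/-- In a full tree of positive depth, the leaves are attached to vertices of degree three. -/
theorem IsFullTree.exists_root {d : ℕ} (hd : 2 ≤ d) (hF : IsFullTree F d) (v : U)
    (hv : (F.neighborSet v).ncard = 1) :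
    ∃ w, (F.neighborSet w).ncard = 3 ∧ ∀ x, F.Adj v x ↔ x = w := by
  obtain ⟨htree, hdeg, c, hc⟩ := hF
  obtain ⟨w, hw⟩ := Set.ncard_eq_one.1 hv
  have hadj : ∀ x, F.Adj v x ↔ x = w := fun x => by
    rw [← SimpleGraph.mem_neighborSet, hw, Set.mem_singleton_iff]
  refine ⟨w, (hdeg w).resolve_left fun hw1 => ?_, hadj⟩
  have h1 := (hc v).1 hv
  have h2 := (hc w).1 hw1
  -- If `w` were also a leaf, it would have the same distance `d` to the centre as `v`. But `w` is
  -- the only neighbour of `v`, so a shortest walk to the centre passes through it and shows that it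
  -- is closer.
  obtain ⟨p, hp⟩ := htree.connected.exists_walk_length_eq_dist v c
  cases p with
  | nil => simp at hp; rw [← h1, SimpleGraph.dist_self] at hd; omega
  | cons h p =>
    obtain rfl := (hadj _).1 h
    have := SimpleGraph.dist_le p
    rw [SimpleGraph.dist_comm] at hp this
    simp at hp
    omega

/-- The legs of a leaf-extended full tree. -/
noncomputable def leafExtendLegs {d : ℕ} (hd : 2 ≤ d) (hF : IsFullTree F d) :
    LegDecomposition (leafExtend F) {v : U // (F.neighborSet v).ncard = 1} 2 where
  core := {v | ∃ u, (F.neighborSet u).ncard = 3 ∧ v = .inl u}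
  root v := .inl (hF.exists_root hd v.1 v.2).choose
  leg v i := if i = 0 then .inl v else .inr v
  pos := by norm_num
  ncard_core := by
    rintro _ ⟨u, hu, rfl⟩
    have : (leafExtend F).neighborSet (.inl u) = Sum.inl '' F.neighborSet u := by
      ext (v | v)
      · simp [leafExtend_adj_inl_inl]
      · simp only [SimpleGraph.mem_neighborSet, leafExtend_adj_inl_inr, Set.mem_image, reduceCtorEq,
          and_false, exists_false, iff_false]
        rintro rfl
        rw [v.2] at hu; omega
    rw [this, Set.ncard_image_of_injective _ Sum.inl_injective, hu]
  root_mem v := ⟨_, (hF.exists_root hd v.1 v.2).choose_spec.1, rfl⟩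
  adj_zero := by
    rintro v (u | u)
    · change (leafExtend F).Adj (.inl v.val) (.inl u) ↔
        Sum.inl u = Sum.inl _ ∨ (1 < 2 ∧ Sum.inl u = Sum.inr v)
      rw [leafExtend_adj_inl_inl, (hF.exists_root hd v.1 v.2).choose_spec.2]
      simp
    · change (leafExtend F).Adj (.inl v.val) (.inr u) ↔
        Sum.inr u = Sum.inl _ ∨ (1 < 2 ∧ Sum.inr u = Sum.inr v)
      rw [leafExtend_adj_inl_inr]
      refine ⟨fun h => Or.inr ⟨by norm_num, congrArg _ (Subtype.ext h.symm)⟩, ?_⟩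
      rintro (h | ⟨-, h⟩)
      · simp at h
      · rw [Sum.inr_injective h]
  adj_succ := by
    rintro v i hi (u | u)
    · obtain rfl : i = 0 := by omega
      change (leafExtend F).Adj (.inr v) (.inl u) ↔ Sum.inl u = Sum.inl v.val ∨ _
      rw [leafExtend_adj_inr_inl, Sum.inl.injEq, or_iff_left]
      rintro ⟨h, -⟩
      omega
    · obtain rfl : i = 0 := by omega
      change (leafExtend F).Adj (.inr v) (.inr u) ↔ Sum.inr u = Sum.inl v.val ∨ _
      refine iff_of_false leafExtend_not_adj_inr_inr ?_
      rintro (h | ⟨h, -⟩)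
      · simp at h
      · omega
  inj := by
    intro u v i j hi hj
    interval_cases i <;> interval_cases j <;> simp
    exact Subtype.ext
  notMem := by
    rintro v i hi ⟨u, hu, h⟩
    interval_cases i
    · obtain rfl := Sum.inl_injective h
      rw [v.2] at hu; omega
    · simp at h
  cover := by
    rintro (u | u)
    · rcases hF.2.1 u with h | h
      · exact Or.inr (Or.inl ⟨⟨u, h⟩, 0, by norm_num, rfl⟩)
      · exact Or.inl ⟨u, h, rfl⟩
    · exact Or.inr (Or.inl ⟨u, 1, by norm_num, rfl⟩)

theorem not_isInherent_leafExtend [Finite U] {d : ℕ} (hd : 2 ≤ d) (hF : IsFullTree F d) {s t}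
    (hs : ((leafExtend F).neighborSet s).ncard = 1) (ht : ((leafExtend F).neighborSet t).ncard = 2)
    (hst : ¬ (leafExtend F).Adj s t) : ¬ (TwoRooted.mk (leafExtend F) s t).IsInherent := by
  have hcover : ∀ v, v ∈ (leafExtendLegs hd hF).core ∨
      ∃ e, ∃ i < 2, v = (leafExtendLegs hd hF).leg e i := by
    rintro (u | u)
    · rcases hF.2.1 u with h | h
      · exact Or.inr ⟨⟨u, h⟩, 0, by norm_num, rfl⟩
      · exact Or.inl ⟨u, h, rfl⟩
    · exact Or.inr ⟨u, 1, by norm_num, rfl⟩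
  exact (leafExtendLegs hd hF).not_isInherent_of_ncard (LegDecomposition.goodCherries_of_cover _ hcover)
    hs (LegDecomposition.not_isPlain_of_cover _ (hcover s)) ht hst

end

/-! ### Rakes and split rakes -/

theorem SimpleGraph.Iso.ncard_neighborSet {V W : Type*} {G : SimpleGraph V} {H : SimpleGraph W}
    (φ : G ≃g H) (v : V) : (H.neighborSet (φ v)).ncard = (G.neighborSet v).ncard := by
  rw [← Set.ncard_image_of_injective (G.neighborSet v) φ.injective]
  congr 1
  ext w
  constructor
  · intro hw
    refine ⟨φ.symm w, ?_, by simp⟩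
    rw [SimpleGraph.mem_neighborSet, ← φ.map_adj_iff]
    simpa using hw
  · rintro ⟨u, hu, rfl⟩
    exact φ.map_adj_iff.2 hu

namespace LegDecomposition

variable {V D : Type} {H : SimpleGraph V}

/-- Plain leaves hang on core vertices, which have degree three. This property survives
automorphisms and distinguishes ends of legs from plain leaves when the roots are known only up to
equivalence. -/
theorem not_isPlain_of_adj (L : LegDecomposition H D 2) {v w : V} (h : H.Adj v w)
    (hw : (H.neighborSet w).ncard = 2) : ¬ L.IsPlain v := by
  rintro ⟨-, c, hc, h'⟩
  obtain rfl := (h' w).1 h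
  rw [L.ncard_core w hc] at hw
  omega

/-- Case of legs with two vertices, up to automorphisms of the graph. -/
theorem not_isInherent_of_equivalent [Finite V] [Finite D] (L : LegDecomposition H D 2)
    (hL : L.GoodCherries) (d₁ d₂ : D) {R : TwoRooted V}
    (hR : (TwoRooted.mk H (L.leg d₁ 1) (L.leg d₂ 0)).Equivalent R) (hadj : ¬ R.graph.Adj R.s R.t) :
    ¬ R.IsInherent := by
  obtain ⟨G, s, t⟩ := R
  obtain ⟨rfl : G = H, ⟨φ, rfl⟩, ⟨ψ, rfl⟩⟩ := hR
  refine L.not_isInherent_of_ncard hL ?_ (L.not_isPlain_of_adj (w := φ (L.leg d₁ 0)) ?_ ?_) ?_ hadj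
  · exact (φ.ncard_neighborSet _).trans (L.ncard_leg_one d₁)
  · exact φ.map_adj_iff.2 ((L.adj_succ d₁ 0 (by norm_num) _).2 (Or.inl rfl))
  · rw [φ.ncard_neighborSet, L.ncard_leg_zero]
  · exact (ψ.ncard_neighborSet _).trans (L.ncard_leg_zero d₂)

end LegDecomposition

section

variable {q : ℕ}

instance : Finite (RakeVertex q) :=
  Finite.of_surjective (Sum.elim RakeVertex.a (Sum.elim RakeVertex.b RakeVertex.c)) (by
    rintro (i | j | j)
    exacts [⟨.inl i, rfl⟩, ⟨.inr (.inl j), rfl⟩, ⟨.inr (.inr j), rfl⟩])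

theorem rake_adj_a_a {i k : Fin (2 + q + 2)} :
    (rake q).Adj (.a i) (.a k) ↔ i.val + 1 = k.val ∨ k.val + 1 = i.val := by
  rw [rake, SimpleGraph.fromRel_adj, and_iff_right_of_imp]
  rintro h ⟨⟩
  omega

theorem rake_adj_a_b {i : Fin (2 + q + 2)} {j : Fin q} : (rake q).Adj (.a i) (.b j) ↔ False := by
  simp [rake]

theorem rake_adj_a_c {i : Fin (2 + q + 2)} {j : Fin q} :
    (rake q).Adj (.a i) (.c j) ↔ i.val = 2 + j.val := by
  simp [rake]

theorem rake_adj_b_a {i : Fin (2 + q + 2)} {j : Fin q} : (rake q).Adj (.b j) (.a i) ↔ False := by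
  simp [rake]

theorem rake_adj_b_b {i j : Fin q} : (rake q).Adj (.b i) (.b j) ↔ False := by
  simp [rake]

theorem rake_adj_b_c {i j : Fin q} : (rake q).Adj (.b i) (.c j) ↔ j = i := by
  simp [rake]

theorem rake_adj_c_a {i : Fin (2 + q + 2)} {j : Fin q} :
    (rake q).Adj (.c j) (.a i) ↔ i.val = 2 + j.val := by
  simp [rake]

theorem rake_adj_c_b {i j : Fin q} : (rake q).Adj (.c i) (.b j) ↔ i = j := by
  simp [rake]

theorem rake_adj_c_c {i j : Fin q} : (rake q).Adj (.c i) (.c j) ↔ False := by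
  simp [rake]

/-- The legs of the rake, all of which have two vertices. -/
def rakeLeg (q : ℕ) : Bool ⊕ Fin q → ℕ → RakeVertex q
  | .inl false, i => .a ⟨1 - i, by omega⟩
  | .inl true, i => .a ⟨min (2 + q + i) (2 + q + 1), by omega⟩
  | .inr j, 0 => .c j
  | .inr j, _ + 1 => .b j

theorem rake_cover (v : RakeVertex q) :
    (∃ i : Fin (2 + q + 2), 2 ≤ i.val ∧ i.val < 2 + q ∧ v = .a i) ∨
      ∃ d, ∃ i < 2, v = rakeLeg q d i := by
  rcases v with k | j | j
  · rcases (by omega : k.val < 2 ∨ (2 ≤ k.val ∧ k.val < 2 + q) ∨ 2 + q ≤ k.val) with h | h | h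
    · refine Or.inr ⟨.inl false, 1 - k, by omega, ?_⟩
      simp [rakeLeg, Fin.ext_iff]; omega
    · exact Or.inl ⟨k, h.1, h.2, rfl⟩
    · refine Or.inr ⟨.inl true, k - (2 + q), by omega, ?_⟩
      simp [rakeLeg, Fin.ext_iff]; omega
  · exact Or.inr ⟨.inr j, 1, by norm_num, rfl⟩
  · exact Or.inr ⟨.inr j, 0, by norm_num, rfl⟩

/-- The core of the rake is a path with a leg at every vertex and a second one at both ends. -/
def rakeLegs (q : ℕ) (hq : 1 ≤ q) : LegDecomposition (rake q) (Bool ⊕ Fin q) 2 where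
  core := {v | ∃ i : Fin (2 + q + 2), 2 ≤ i.val ∧ i.val < 2 + q ∧ v = .a i}
  root
    | .inl false => .a ⟨2, by omega⟩
    | .inl true => .a ⟨q + 1, by omega⟩
    | .inr j => .a ⟨2 + j, by omega⟩
  leg := rakeLeg q
  pos := by norm_num
  ncard_core := by
    rintro _ ⟨i, h1, h2, rfl⟩
    rw [Set.ncard_eq_three]
    refine ⟨.a ⟨i - 1, by omega⟩, .a ⟨i + 1, by omega⟩, .c ⟨i - 2, by omega⟩, ?_, by simp, by simp,
      ?_⟩
    · simp only [ne_eq, RakeVertex.a.injEq, Fin.mk.injEq]; omega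
    · ext (k | j | j) <;>
        simp [Fin.ext_iff, rake_adj_a_a, rake_adj_a_b, rake_adj_a_c] <;> omega
  root_mem := by
    rintro ((_ | _) | j)
    · exact ⟨_, le_rfl, by simp only; omega, rfl⟩
    · exact ⟨_, by simp only; omega, by simp only; omega, rfl⟩
    · exact ⟨_, by simp only; omega, by simp only; omega, rfl⟩
  adj_zero := by
    rintro ((_ | _) | j) (k | k | k)
    all_goals
      simp only [rakeLeg, rake_adj_a_a, rake_adj_a_b, rake_adj_a_c, rake_adj_c_a, rake_adj_c_b,
        rake_adj_c_c, RakeVertex.a.injEq, RakeVertex.b.injEq, reduceCtorEq,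
        Fin.ext_iff, and_false, false_or, or_false, iff_false, Nat.one_lt_ofNat, true_and]
    all_goals omega
  adj_succ := by
    rintro ((_ | _) | j) i hi (k | k | k) <;> obtain rfl : i = 0 := by omega
    all_goals
      simp only [rakeLeg, rake_adj_a_a, rake_adj_a_b, rake_adj_a_c, rake_adj_b_a, rake_adj_b_b,
        rake_adj_b_c, RakeVertex.a.injEq, RakeVertex.b.injEq, RakeVertex.c.injEq, reduceCtorEq,
        Fin.ext_iff, and_false, or_false, iff_false, zero_add, lt_irrefl, false_and]
    all_goals omega
  inj := by
    rintro ((_ | _) | j) ((_ | _) | j') i i' hi hi' <;> interval_cases i <;> interval_cases i' <;>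
      simp [rakeLeg, Fin.ext_iff]
    all_goals omega
  notMem := by
    rintro ((_ | _) | j) i hi ⟨k, h1, h2, h3⟩ <;> interval_cases i <;>
      simp [rakeLeg, Fin.ext_iff] at h3 <;> omega
  cover v := (rake_cover v).imp id Or.inl

theorem not_isInherent_rake (hq : 1 ≤ q) {R : TwoRooted (RakeVertex q)} (hR : (T₄ q).Equivalent R)
    (hadj : ¬ R.graph.Adj R.s R.t) : ¬ R.IsInherent := by
  refine (rakeLegs q hq).not_isInherent_of_equivalent
    (LegDecomposition.goodCherries_of_cover _ rake_cover) (.inl false) (.inl true) ?_ hadj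
  convert hR using 1
  simp [T₄, rakeLegs, rakeLeg, Fin.ext_iff]; omega

end

section

variable {q : ℕ}

instance : Finite (SplitRakeVertex q) :=
  Finite.of_surjective
    (Sum.elim SplitRakeVertex.a (Sum.elim SplitRakeVertex.b (Sum.elim SplitRakeVertex.c
      SplitRakeVertex.d))) (by
    rintro (i | j | j | j)
    exacts [⟨.inl i, rfl⟩, ⟨.inr (.inl j), rfl⟩, ⟨.inr (.inr (.inl j)), rfl⟩,
      ⟨.inr (.inr (.inr j)), rfl⟩])

theorem splitRake_adj_a_a {i k : Fin (2 + q + 2)} :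
    (splitRake q).Adj (.a i) (.a k) ↔ i.val + 1 = k.val ∨ k.val + 1 = i.val := by
  rw [splitRake, SimpleGraph.fromRel_adj, and_iff_right_of_imp]
  rintro h ⟨⟩
  omega

theorem splitRake_adj_a_b {i : Fin (2 + q + 2)} {j : Fin q} :
    (splitRake q).Adj (.a i) (.b j) ↔ False := by
  simp [splitRake]

theorem splitRake_adj_a_c {i : Fin (2 + q + 2)} {j : Fin q} :
    (splitRake q).Adj (.a i) (.c j) ↔ i.val = 2 + j.val := by
  simp [splitRake]

theorem splitRake_adj_a_d {i : Fin (2 + q + 2)} {j} :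
    (splitRake q).Adj (.a i) (.d j) ↔ False := by
  simp [splitRake]

theorem splitRake_adj_b_a {i : Fin (2 + q + 2)} {j : Fin q} :
    (splitRake q).Adj (.b j) (.a i) ↔ False := by
  simp [splitRake]

theorem splitRake_adj_b_b {i j : Fin q} : (splitRake q).Adj (.b i) (.b j) ↔ False := by
  simp [splitRake]

theorem splitRake_adj_b_c {i j : Fin q} : (splitRake q).Adj (.b i) (.c j) ↔ j = i := by
  simp [splitRake]

theorem splitRake_adj_b_d {i : Fin q} {j} : (splitRake q).Adj (.b i) (.d j) ↔ False := by
  simp [splitRake]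

theorem splitRake_adj_c_a {i : Fin (2 + q + 2)} {j : Fin q} :
    (splitRake q).Adj (.c j) (.a i) ↔ i.val = 2 + j.val := by
  simp [splitRake]

theorem splitRake_adj_c_b {i j : Fin q} : (splitRake q).Adj (.c i) (.b j) ↔ i = j := by
  simp [splitRake]

theorem splitRake_adj_c_c {i j : Fin q} : (splitRake q).Adj (.c i) (.c j) ↔ False := by
  simp [splitRake]

theorem splitRake_adj_c_d {i : Fin q} {j} : (splitRake q).Adj (.c i) (.d j) ↔ i = j.val := by
  simp [splitRake]

theorem splitRake_adj_d_a {i : Fin (2 + q + 2)} {j} :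
    (splitRake q).Adj (.d j) (.a i) ↔ False := by
  simp [splitRake]

theorem splitRake_adj_d_b {i : Fin q} {j} : (splitRake q).Adj (.d j) (.b i) ↔ False := by
  simp [splitRake]

theorem splitRake_adj_d_c {i : Fin q} {j} : (splitRake q).Adj (.d j) (.c i) ↔ i = j.val := by
  simp [splitRake]

theorem splitRake_adj_d_d {i j} : (splitRake q).Adj (.d i) (.d j) ↔ False := by
  simp [splitRake]

/-- The legs of the split rake with two vertices: two at both ends of the path. -/
def splitRakeLeg (q : ℕ) (hq : 1 ≤ q) : Bool × Bool → ℕ → SplitRakeVertex q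
  | (false, false), i => .a ⟨1 - i, by omega⟩
  | (true, false), i => .a ⟨min (2 + q + i) (2 + q + 1), by omega⟩
  | (false, true), 0 => .c ⟨0, by omega⟩
  | (false, true), _ + 1 => .b ⟨0, by omega⟩
  | (true, true), 0 => .c ⟨q - 1, by omega⟩
  | (true, true), _ + 1 => .b ⟨q - 1, by omega⟩

/-- The vertices with three neighbours in the split rake. -/
def splitRakeCore (q : ℕ) : Set (SplitRakeVertex q) :=
  {v | (∃ i : Fin (2 + q + 2), 2 ≤ i.val ∧ i.val < 2 + q ∧ v = .a i) ∨
    ∃ j : Fin q, j.val ≠ 0 ∧ j.val + 1 ≠ q ∧ v = .c j}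

theorem splitRake_a_cover (hq : 1 ≤ q) (k : Fin (2 + q + 2)) :
    SplitRakeVertex.a k ∈ splitRakeCore q ∨
      ∃ d, ∃ i < 2, SplitRakeVertex.a k = splitRakeLeg q hq d i := by
  rcases (by omega : k.val < 2 ∨ (2 ≤ k.val ∧ k.val < 2 + q) ∨ 2 + q ≤ k.val) with h | h | h
  · refine Or.inr ⟨(false, false), 1 - k, by omega, ?_⟩
    simp [splitRakeLeg, Fin.ext_iff]; omega
  · exact Or.inl (Or.inl ⟨k, h.1, h.2, rfl⟩)
  · refine Or.inr ⟨(true, false), k - (2 + q), by omega, ?_⟩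
    simp [splitRakeLeg, Fin.ext_iff]; omega

theorem splitRake_c_cover (hq : 1 ≤ q) (k : Fin q) :
    SplitRakeVertex.c k ∈ splitRakeCore q ∨
      ∃ d, ∃ i < 2, SplitRakeVertex.c k = splitRakeLeg q hq d i := by
  by_cases h0 : k.val = 0
  · exact Or.inr ⟨(false, true), 0, by norm_num, congrArg _ (Fin.ext h0)⟩
  · by_cases h1 : k.val + 1 = q
    · exact Or.inr ⟨(true, true), 0, by norm_num, congrArg _ (Fin.ext (by simp only; omega))⟩
    · exact Or.inl (Or.inr ⟨k, h0, h1, rfl⟩)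

/-- The core of the split rake is a path with a vertex attached to every inner vertex. -/
def splitRakeLegs (q : ℕ) (hq : 2 ≤ q) : LegDecomposition (splitRake q) (Bool × Bool) 2 where
  core := splitRakeCore q
  root
    | (false, _) => .a ⟨2, by omega⟩
    | (true, _) => .a ⟨q + 1, by omega⟩
  leg := splitRakeLeg q (by omega)
  pos := by norm_num
  ncard_core := by
    rintro _ (⟨i, h1, h2, rfl⟩ | ⟨j, h1, h2, rfl⟩)
    · rw [Set.ncard_eq_three]
      refine ⟨.a ⟨i - 1, by omega⟩, .a ⟨i + 1, by omega⟩, .c ⟨i - 2, by omega⟩, ?_, by simp,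
        by simp, ?_⟩
      · simp only [ne_eq, SplitRakeVertex.a.injEq, Fin.mk.injEq]; omega
      · ext (k | j | j | j) <;>
          simp [Fin.ext_iff, splitRake_adj_a_a, splitRake_adj_a_b, splitRake_adj_a_c,
            splitRake_adj_a_d] <;> omega
    · rw [Set.ncard_eq_three]
      refine ⟨.a ⟨2 + j, by omega⟩, .b j, .d ⟨j, h1, h2⟩, by simp, by simp, by simp, ?_⟩
      ext (k | k | k | k)
      · simp [splitRake_adj_c_a, Fin.ext_iff]
      · simp [splitRake_adj_c_b, eq_comm]
      · simp [splitRake_adj_c_c]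
      · simp only [SimpleGraph.mem_neighborSet, splitRake_adj_c_d, Set.mem_insert_iff,
          reduceCtorEq, Set.mem_singleton_iff, SplitRakeVertex.d.injEq, false_or]
        exact ⟨fun h => Subtype.ext h.symm, fun h => by rw [h]⟩
  root_mem := by
    rintro (⟨_ | _, _⟩)
    · exact Or.inl ⟨_, le_rfl, by simp only; omega, rfl⟩
    · exact Or.inl ⟨_, by simp only; omega, by simp only; omega, rfl⟩
  adj_zero := by
    rintro ⟨_ | _, _ | _⟩ (k | k | k | ⟨k, h1, h2⟩)
    all_goals
      simp only [splitRakeLeg, splitRake_adj_a_a, splitRake_adj_a_b, splitRake_adj_a_c,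
        splitRake_adj_a_d, splitRake_adj_c_a, splitRake_adj_c_b, splitRake_adj_c_c,
        splitRake_adj_c_d, SplitRakeVertex.a.injEq, SplitRakeVertex.b.injEq, reduceCtorEq,
        Fin.ext_iff, and_false, false_or, or_false, iff_false, Nat.one_lt_ofNat, true_and]
    all_goals omega
  adj_succ := by
    rintro ⟨_ | _, _ | _⟩ i hi (k | k | k | ⟨k, h1, h2⟩) <;> obtain rfl : i = 0 := by omega
    all_goals
      simp only [splitRakeLeg, splitRake_adj_a_a, splitRake_adj_a_b, splitRake_adj_a_c,
        splitRake_adj_a_d, splitRake_adj_b_a, splitRake_adj_b_b, splitRake_adj_b_c,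
        splitRake_adj_b_d, SplitRakeVertex.a.injEq, SplitRakeVertex.b.injEq,
        SplitRakeVertex.c.injEq, reduceCtorEq, Fin.ext_iff, and_false, or_false, iff_false,
        zero_add, lt_irrefl, false_and]
    all_goals omega
  inj := by
    rintro ⟨_ | _, _ | _⟩ ⟨_ | _, _ | _⟩ i i' hi hi' <;> interval_cases i <;> interval_cases i' <;>
      simp [splitRakeLeg, Fin.ext_iff]
    all_goals omega
  notMem := by
    rintro ⟨_ | _, _ | _⟩ i hi (⟨k, h1, h2, h3⟩ | ⟨k, h1, h2, h3⟩) <;> interval_cases i <;>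
      simp [splitRakeLeg, Fin.ext_iff] at h3 <;> omega
  cover := by
    have hc : ∀ j : Fin q, j.val ≠ 0 → j.val + 1 ≠ q → SplitRakeVertex.c j ∈ splitRakeCore q :=
      fun j h1 h2 => Or.inr ⟨j, h1, h2, rfl⟩
    rintro (k | j | k | ⟨j, h1, h2⟩)
    · exact (splitRake_a_cover _ k).imp id Or.inl
    · by_cases h0 : j.val = 0
      · exact Or.inr (Or.inl ⟨(false, true), 1, by norm_num, congrArg _ (Fin.ext h0)⟩)
      · by_cases h1 : j.val + 1 = q
        · exact Or.inr (Or.inl ⟨(true, true), 1, by norm_num,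
            congrArg _ (Fin.ext (by simp only; omega))⟩)
        · refine Or.inr (Or.inr ⟨by norm_num, _, hc j h0 h1, ?_⟩)
          rintro (k | k | k | k) <;>
            simp [splitRake_adj_b_a, splitRake_adj_b_b, splitRake_adj_b_c, splitRake_adj_b_d]
    · exact (splitRake_c_cover _ k).imp id Or.inl
    · refine Or.inr (Or.inr ⟨by norm_num, _, hc j h1 h2, ?_⟩)
      rintro (k | k | k | k) <;>
        simp [splitRake_adj_d_a, splitRake_adj_d_b, splitRake_adj_d_c, splitRake_adj_d_d]

/-- The cherries are the inner subdividing vertices `c j`. The vertex `w` is the path vertex below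
`c j`: its other neighbours are path vertices, which are never cherries. The four legs come in two
pairs with a common root, so every root has a second leg. -/
theorem splitRakeLegs_goodCherries (q : ℕ) (hq : 2 ≤ q) : (splitRakeLegs q hq).GoodCherries := by
  have ha : ∀ k, ¬ (splitRakeLegs q hq).IsCherry (.a k) := by
    rintro k ⟨y, -, -, hy, -, hadj, -⟩
    rcases y with i | j | j | j
    · exact LegDecomposition.not_isPlain_of_cover _ (splitRake_a_cover (by omega) i) hy
    · rwa [splitRake_adj_a_b] at hadj
    · exact LegDecomposition.not_isPlain_of_cover _ (splitRake_c_cover (by omega) j) hy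
    · rwa [splitRake_adj_a_d] at hadj
  rintro _ (⟨i, h1, h2, rfl⟩ | ⟨j, h1, h2, rfl⟩) hcherry
  · exact absurd hcherry (ha i)
  · refine ⟨.a ⟨2 + j, by omega⟩, Or.inl ⟨_, by simp, by simp, rfl⟩, by rw [splitRake_adj_c_a],
      ?_, ?_⟩
    · rintro (k | k | k | k) h
      · rw [splitRake_adj_a_a] at h
        simp only at h
        exact ⟨Or.inl ⟨k, by omega, by omega, rfl⟩, fun _ => ha k⟩
      · rw [splitRake_adj_a_b] at h; exact h.elim
      · rw [splitRake_adj_a_c] at h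
        obtain rfl : j = k := Fin.ext (by simp only at h; omega)
        exact ⟨Or.inr ⟨j, h1, h2, rfl⟩, fun h => absurd rfl h⟩
      · rw [splitRake_adj_a_d] at h; exact h.elim
    · rintro ⟨e, b⟩
      exact ⟨(e, !b), by simp, by cases e <;> rfl⟩

theorem not_isInherent_splitRake (hq : 2 ≤ q) {R : TwoRooted (SplitRakeVertex q)}
    (hR : (T₅ q).Equivalent R) (hadj : ¬ R.graph.Adj R.s R.t) : ¬ R.IsInherent := by
  refine (splitRakeLegs q hq).not_isInherent_of_equivalent (splitRakeLegs_goodCherries q hq)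
    (false, false) (true, false) ?_ hadj
  convert hR using 1
  simp [T₅, splitRakeLegs, splitRakeLeg, Fin.ext_iff]; omega

end

/-! ### Paths and the main theorem -/

namespace TwoRooted

theorem IsInherent.of_iso {V V' : Type*} {R : TwoRooted V} {R' : TwoRooted V'} (h : R.IsInherent)
    (e : R.graph ≃g R'.graph) (hs : e R.s = R'.s) (ht : e R.t = R'.t) : R'.IsInherent := by
  rintro W _ G ⟨f⟩
  obtain ⟨S, s, t, ⟨g, hg, hgs, hgt⟩, hav⟩ := h W G ⟨e.toRelEmbedding.trans f⟩
  refine ⟨S, s, t, ⟨e.symm.toRelEmbedding.trans g, ?_, ?_, ?_⟩, hav⟩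
  · rw [← hg]
    exact e.symm.surjective.range_comp g
  · rw [← hgs, ← hs]; simp
  · rw [← hgt, ← ht]; simp

end TwoRooted

/-- The path with `ℓ` edges is the comb without teeth. -/
def pathIso (ℓ : ℕ) : SimpleGraph.pathGraph (ℓ + 1) ≃g comb 1 0 ℓ where
  toFun i := .a ⟨i, by omega⟩
  invFun
    | .a i => ⟨i, by omega⟩
    | .b j => j.elim0
  left_inv _ := rfl
  right_inv
    | .a _ => rfl
    | .b j => j.elim0
  map_rel_iff' := by
    intro i j
    rw [SimpleGraph.pathGraph_adj]
    exact comb_adj_a_a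

/-- For `ℓ = 2` a path can turn back between twins, so the twin cycle is replaced by the Petersen
graph. -/
theorem not_isInherent_path_zero {ℓ : ℕ} (hℓ : 1 ≤ ℓ) : ¬ (TwoRooted.path ℓ 0).IsInherent := by
  by_cases h2 : ℓ = 2
  · subst h2
    exact fun h => BitGraph.not_isInherent_T₁_1_0_2 (hp := le_rfl) (h.of_iso (pathIso 2) rfl rfl)
  · exact not_isInherent_path hℓ h2 0 (by omega) (Or.inl rfl)

theorem not_isInherent_T₁_1_0_3 {hp} : ¬ (T₁ 1 0 3 hp).IsInherent := by
  intro h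
  exact not_isInherent_path_zero (ℓ := 3) (by norm_num) (h.of_iso (pathIso 3).symm rfl rfl)

theorem mainTheorem6 :
    -- two-rooted combs of type II
    (∀ (p q : ℕ) (hp : 1 ≤ p), 1 ≤ q → ¬ (T₂ p q hp).IsInherent) ∧
    -- two-rooted rakes and two-rooted split rakes
    (∀ (q : ℕ), 2 ≤ q → ∀ R : TwoRooted (RakeVertex q), (T₄ q).Equivalent R →
      ¬ R.graph.Adj R.s R.t → ¬ R.IsInherent) ∧
    (∀ (q : ℕ), 3 ≤ q → ∀ R : TwoRooted (SplitRakeVertex q), (T₅ q).Equivalent R →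
      ¬ R.graph.Adj R.s R.t → ¬ R.IsInherent) ∧
    -- two-rooted leaf-extended full trees with non-adjacent roots
    (∀ (U : Type) [Finite U] (F : SimpleGraph U) (d : ℕ), 2 ≤ d → IsFullTree F d →
      ∀ s t, ((leafExtend F).neighborSet s).ncard = 1 → ((leafExtend F).neighborSet t).ncard = 2 →
        ¬ (leafExtend F).Adj s t → ¬ (TwoRooted.mk (leafExtend F) s t).IsInherent) ∧
    -- two-rooted paths
    (∀ (ℓ : ℕ), 1 ≤ ℓ → ¬ (TwoRooted.path ℓ 0).IsInherent) ∧
    (∀ (ℓ : ℕ), 3 ≤ ℓ → ¬ (TwoRooted.path ℓ ⟨ℓ - 1, by omega⟩).IsInherent) ∧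
    -- two-rooted combs of type I
    (¬ (T₁ 1 0 2 (by norm_num)).IsInherent ∧
      ¬ (T₁ 1 0 3 (by norm_num)).IsInherent ∧
      ¬ (T₁ 1 1 1 (by norm_num)).IsInherent ∧
      ¬ (T₁ 1 1 2 (by norm_num)).IsInherent ∧
      ¬ (T₁ 1 2 1 (by norm_num)).IsInherent ∧
      ¬ (T₁ 1 3 1 (by norm_num)).IsInherent ∧
      ¬ (T₁ 1 4 1 (by norm_num)).IsInherent ∧
      ¬ (T₁ 2 0 2 (by norm_num)).IsInherent ∧
      ¬ (T₁ 2 0 3 (by norm_num)).IsInherent ∧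
      ¬ (T₁ 2 1 1 (by norm_num)).IsInherent ∧
      ¬ (T₁ 2 1 2 (by norm_num)).IsInherent ∧
      ¬ (T₁ 2 2 1 (by norm_num)).IsInherent ∧
      ¬ (T₁ 2 3 1 (by norm_num)).IsInherent ∧
      ¬ (T₁ 2 4 1 (by norm_num)).IsInherent ∧
      ¬ (T₁ 3 0 3 (by norm_num)).IsInherent) := by
  refine ⟨fun p q hp hq => not_isInherent_T₂ p q hp hq,
    fun q hq R hR hadj => not_isInherent_rake (by omega) hR hadj,
    fun q hq R hR hadj => not_isInherent_splitRake (by omega) hR hadj,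
    fun U _ F d hd hF s t hs ht hst => not_isInherent_leafExtend hd hF hs ht hst,
    fun ℓ hℓ => not_isInherent_path_zero hℓ,
    fun ℓ hℓ => not_isInherent_path (by omega) (by omega) (ℓ - 1) (by omega) (Or.inr rfl),
    BitGraph.not_isInherent_T₁_1_0_2,
    not_isInherent_T₁_1_0_3,
    BitGraph.not_isInherent_T₁_1_1_1,
    BitGraph.not_isInherent_T₁_1_1_2,
    BitGraph.not_isInherent_T₁_1_2_1,
    BitGraph.not_isInherent_T₁_1_3_1,
    BitGraph.not_isInherent_T₁_1_4_1,
    BitGraph.not_isInherent_T₁_2_0_2,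
    BitGraph.not_isInherent_T₁_2_0_3,
    BitGraph.not_isInherent_T₁_2_1_1,
    BitGraph.not_isInherent_T₁_2_1_2,
    BitGraph.not_isInherent_T₁_2_2_1,
    BitGraph.not_isInherent_T₁_2_3_1,
    BitGraph.not_isInherent_T₁_2_4_1,
    BitGraph.not_isInherent_T₁_3_0_3⟩
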